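/- Let $G$ be a connected real Lie group with Lie algebra $\mathfrak g$, let $\mathbf G$ be a nondegenerate symmetric bilinear form on $\mathfrak g$, let $\mathbf F\in \mathbf Z^2(\mathfrak g;\mathbb R)$ be a 2-cocycle, and let $\mathrm e\in\mathbb R$. Denote by $\mathrm g_{ij}$ and $\mathrm F_{ij}$ the components, in local coordinates $g^i$ on $G$, of the right-invariant metric and of the right-invariant closed 2-form with the values $\mathbf G$ and $\mathbf F$ at the unit, and put $H=\tfrac12 \mathrm g^{ij}(g)p_ip_j$. The magnetic geodesic flow on $T^*G$ is $$\dot g^i=\frac{\partial H}{\partial p_i},\qquad \dot p_i=-\frac{\partial H}{\partial g^i}-\mathrm e\,\mathrm F_{ij}(g)\frac{\partial H}{\partial p_j}. \tag{11}$$ Let $\widetilde G$ be a connected Lie group with Lie algebra $\widetilde{\mathfrak g}=\mathfrak g\oplus\mathbb R Z$, $Z$ central, $[X,Y]_{\mathbf F}=[X,Y]+\mathbf F(X,Y)Z$, which is a central extension of $G$: there is a smooth surjective homomorphism $\pi:\widetilde G\to G$ whose differential at the unit is the projection $\widetilde{\mathfrak g}\to\mathfrak g$, and the one-parameter subgroup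 $T=\exp(\mathbb RZ)$ is central. Let $B$ be the right-invariant quadratic form on $T^*\widetilde G$ whose value at the unit is the pull-back of $\mathbf G^{-1}$ under the restriction map $\widetilde{\mathfrak g}^*\to\mathfrak g^*$, and put $\widetilde H=\tfrac12B(p,p)$. A local section $s$ of $\pi$ defines the coordinates $(g^0,g^i)$ of the point $s(g)\exp(g^0Z)$ of $\widetilde G$. The subsystem, at the level $p_0=-\mathrm e$, of the canonical Hamiltonian system of $\widetilde H$ is $$\dot g^i=\frac{\partial\widetilde H}{\partial p_i},\qquad \dot p_i=-\frac{\partial\widetilde H}{\partial g^i}. \tag{37}$$ A system $\dot y=X(y)$ on an open subset $M$ of $\mathbb R^m$ is called integrable in quadratures if every nonempty open $O\subseteq M$ contains a nonempty open set $U$ such that, for some $\varepsilon>0$, the general solution $\Psi(t,y)$ with $\Psi(0,y)=y$ and values in $O$ is defined for $|t|<\varepsilon$, $y\in U$, and is obtained from the components of $X|_O$, the constants and the coordinates by finitely many arithmetic operations, substitutions, differentiations, (smooth local) inversions of maps and quadratures, i.e. integrations of functions already obtained with respect to one of their variables (the other variables being parameters). Then, for every local coordinate system $g^i$ on $G$: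 (i) System (11) is integrable in quadratures in the coordinates $(g^i,p_i)$ if and only if system (37) is, the latter meaning that (37) is integrable in quadratures in the coordinates given by any local section $s$ of $\pi$ over an open part of the coordinate domain. (ii) For every such section $s$, over an open set $W$: the coordinate $g^0$ is cyclic, so that $p_0$ is an integral of motion of the Hamiltonian system of $\widetilde H$; at the level $p_0=-\mathrm e$ the right-hand sides of (37) do not depend on $g^0$; the functions $A_i=-\widetilde\eta^{\,0}_a\sigma^a_i$ on $W$, where $\widetilde\eta^{\,0}_a$ is the $\partial/\partial g^0$-component of the right-invariant field $\widetilde\eta_a=-(R_g)_*e_a$ on $\widetilde G$ ($e_a$ a basis of $\mathfrak g$) and $\sigma^a$ are the right-invariant 1-forms on $G$ dual to the fields $\eta_a=-(R_g)_*e_a$, are smooth and form a vector potential, $\partial_iA_j-\partial_jA_i=\mathrm F_{ij}$; and the shift $(g,p)\mapsto(g,\,p+\mathrm eA(g))$ takes (37) to (11). -/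

import Mathlib

open Set
open scoped Manifold ContDiff

noncomputable section

namespace MagneticFlow

/-! ### Integrability in quadratures -/

/-- The partial derivative of `f` with respect to the coordinate `i`. -/
def pd {ι : Type} [Fintype ι] (i : ι) (f : (ι → ℝ) → ℝ) (x : ι → ℝ) : ℝ :=
  open Classical in fderiv ℝ f x (Pi.single i 1)

/-- `Quad M X U f` says that the function `f` of finitely many real variables, considered on the
open set `U`, is obtained from the components on `M` of the vector field `X`, from constants and
from coordinates, by finitely many elementary operations: arithmetic operations, substitution of
functions into functions, differentiation, inversion of functions (local inverses of maps), and
quadratures (integration of a function that has already been obtained with respect to one of its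
variables). -/
inductive Quad {κ : Type} (M : Set (κ → ℝ)) (X : (κ → ℝ) → κ → ℝ) :
    ∀ {ι : Type} [Fintype ι], Set (ι → ℝ) → ((ι → ℝ) → ℝ) → Prop
  /-- The components of the given vector field are known. -/
  | component [Fintype κ] (hM : IsOpen M) (k : κ) : Quad M X M (fun x => X x k)
  | const {ι : Type} [Fintype ι] {U : Set (ι → ℝ)} (hU : IsOpen U) (c : ℝ) :
      Quad M X U (fun _ => c)
  | coord {ι : Type} [Fintype ι] {U : Set (ι → ℝ)} (hU : IsOpen U) (i : ι) :
      Quad M X U (fun x => x i)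
  | restrict {ι : Type} [Fintype ι] {U V : Set (ι → ℝ)} {f : (ι → ℝ) → ℝ}
      (hf : Quad M X U f) (hV : IsOpen V) (hVU : V ⊆ U) : Quad M X V f
  | congr {ι : Type} [Fintype ι] {U : Set (ι → ℝ)} {f g : (ι → ℝ) → ℝ}
      (hf : Quad M X U f) (hfg : EqOn f g U) : Quad M X U g
  | add {ι : Type} [Fintype ι] {U : Set (ι → ℝ)} {f g : (ι → ℝ) → ℝ}
      (hf : Quad M X U f) (hg : Quad M X U g) : Quad M X U (fun x => f x + g x)
  | mul {ι : Type} [Fintype ι] {U : Set (ι → ℝ)} {f g : (ι → ℝ) → ℝ}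
      (hf : Quad M X U f) (hg : Quad M X U g) : Quad M X U (fun x => f x * g x)
  | inv {ι : Type} [Fintype ι] {U : Set (ι → ℝ)} {f : (ι → ℝ) → ℝ}
      (hf : Quad M X U f) (h0 : ∀ x ∈ U, f x ≠ 0) : Quad M X U (fun x => (f x)⁻¹)
  /-- Substitution of known functions into a known function. -/
  | comp {ι ι' : Type} [Fintype ι] [Fintype ι'] {U : Set (ι → ℝ)} {V : Set (ι' → ℝ)}
      {f : (ι' → ℝ) → ℝ} {g : ι' → (ι → ℝ) → ℝ} (hU : IsOpen U)
      (hf : Quad M X V f) (hg : ∀ j, Quad M X U (g j))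
      (hUV : MapsTo (fun x j => g j x) U V) : Quad M X U (fun x => f (fun j => g j x))
  | deriv {ι : Type} [Fintype ι] {U : Set (ι → ℝ)} {f : (ι → ℝ) → ℝ}
      (hf : Quad M X U f) (i : ι) : Quad M X U (pd i f)
  /-- Inversion: the components of a smooth local inverse `h` of a known map `g`. -/
  | inversion {ι : Type} [Fintype ι] {U V : Set (ι → ℝ)} {g : ι → (ι → ℝ) → ℝ}
      {h : (ι → ℝ) → ι → ℝ} (hg : ∀ j, Quad M X U (g j)) (hV : IsOpen V)
      (hVU : MapsTo h V U) (hh : ContDiffOn ℝ ∞ h V)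
      (hgh : ∀ y ∈ V, ∀ j, g j (h y) = y j) (i : ι) : Quad M X V (fun y => h y i)
  /-- Quadrature: integration of a known function with respect to one of its variables. -/
  | quadrature {ι : Type} [Fintype ι] [DecidableEq ι] {U V : Set (ι → ℝ)} {f : (ι → ℝ) → ℝ}
      (hf : Quad M X U f) (hV : IsOpen V) (i : ι) (c : ℝ)
      (hVU : ∀ x ∈ V, ∀ s ∈ uIcc c (x i), Function.update x i s ∈ U) :
      Quad M X V (fun x => ∫ s in c..(x i), f (Function.update x i s))

/-- The system `ẏ = X y` on the open set `M` is integrable in quadratures: in each nonempty open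
part `O` of `M` there are points near which the general solution `Ψ t y`, as a function of time and
of the initial condition, is obtained by quadratures from the right-hand side of the system
on `O`. (In particular, the set of points of `M` near which this is possible is open and dense.) -/
def IntegrableInQuadratures {κ : Type} [Fintype κ] (M : Set (κ → ℝ))
    (X : (κ → ℝ) → κ → ℝ) : Prop :=
  ∀ O : Set (κ → ℝ), O ⊆ M → IsOpen O → O.Nonempty →
    ∃ (ε : ℝ) (U : Set (κ → ℝ)) (Ψ : ℝ → (κ → ℝ) → κ → ℝ),
      0 < ε ∧ U ⊆ O ∧ IsOpen U ∧ U.Nonempty ∧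
      (∀ y ∈ U, Ψ 0 y = y ∧ ∀ t ∈ Ioo (-ε) ε,
        Ψ t y ∈ O ∧ HasDerivAt (fun s => Ψ s y) (X (Ψ t y)) t) ∧
      ∀ k : κ, Quad O X
        {w : Option κ → ℝ | w none ∈ Ioo (-ε) ε ∧ (fun j => w (some j)) ∈ U}
        (fun w => Ψ (w none) (fun j => w (some j)) k)

/-! ### Hamiltonian vector fields in canonical coordinates

A phase point with coordinates `x i` and momenta `p i` is a function on `ι ⊕ ι`: its value at
`Sum.inl i` is `x i` and its value at `Sum.inr i` is `p i`. -/

/-- The part of the phase space over the set `W` of positions. -/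
def phaseDomain {ι : Type} (W : Set (ι → ℝ)) : Set (ι ⊕ ι → ℝ) :=
  {z | (fun i => z (Sum.inl i)) ∈ W}

/-- The canonical Hamiltonian vector field `ẋ = ∂H/∂p`, `ṗ = -∂H/∂x`. -/
def hamField {ι : Type} [Fintype ι] (H : (ι ⊕ ι → ℝ) → ℝ) (z : ι ⊕ ι → ℝ) : ι ⊕ ι → ℝ
  | Sum.inl i => pd (Sum.inr i) H z
  | Sum.inr i => - pd (Sum.inl i) H z

/-- The Hamiltonian vector field for the symplectic form deformed by `e` times the 2-form with the
components `F x i j`: `ẋᵢ = ∂H/∂pᵢ`, `ṗᵢ = -∂H/∂xᵢ - e ∑ⱼ Fᵢⱼ(x) ∂H/∂pⱼ`. -/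
def magField {ι : Type} [Fintype ι] (e : ℝ) (F : (ι → ℝ) → ι → ι → ℝ)
    (H : (ι ⊕ ι → ℝ) → ℝ) (z : ι ⊕ ι → ℝ) : ι ⊕ ι → ℝ
  | Sum.inl i => pd (Sum.inr i) H z
  | Sum.inr i => - pd (Sum.inl i) H z
      - e * ∑ j, F (fun k => z (Sum.inl k)) i j * pd (Sum.inr j) H z

/-- The shift of momenta `pᵢ ↦ pᵢ + e Aᵢ(x)`. -/
def momentumShift {ι : Type} (e : ℝ) (A : (ι → ℝ) → ι → ℝ) (z : ι ⊕ ι → ℝ) : ι ⊕ ι → ℝ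
  | Sum.inl i => z (Sum.inl i)
  | Sum.inr i => z (Sum.inr i) + e * A (fun k => z (Sum.inl k)) i

/-! ### Right-invariant objects on a Lie group in local coordinates -/

section LieGroup

variable {E : Type*} [NormedAddCommGroup E] [NormedSpace ℝ E]
  {G : Type*} [TopologicalSpace G] [ChartedSpace E G] [Group G]

instance [FiniteDimensional ℝ E] : FiniteDimensional ℝ (GroupLieAlgebra 𝓘(ℝ, E) G) :=
  inferInstanceAs (FiniteDimensional ℝ E)

/-- `F` is a 2-cocycle of the Lie algebra with values in the trivial module `ℝ`. -/
structure IsTwoCocycle (F : LinearMap.BilinForm ℝ (GroupLieAlgebra 𝓘(ℝ, E) G)) : Prop where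
  alt : ∀ X, F X X = 0
  closed : ∀ X Y Z, F X ⁅Y, Z⁆ + F Y ⁅Z, X⁆ + F Z ⁅X, Y⁆ = 0

/-- Given local coordinates on `G` through their (inverse) parametrization `Φ`, the map that sends
a tangent vector `v` at the point with coordinates `x` to its right translate `(R_{g⁻¹})_* v` in
the Lie algebra, `g = Φ x`. -/
def rightForm {ι : Type} [Fintype ι] (Φ : (ι → ℝ) → G) (x : ι → ℝ) :
    (ι → ℝ) →L[ℝ] GroupLieAlgebra 𝓘(ℝ, E) G :=
  (mfderiv 𝓘(ℝ, ι → ℝ) 𝓘(ℝ, E) (fun y => Φ y * (Φ x)⁻¹) x : (ι → ℝ) →L[ℝ] E)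

/-- The velocity, in the coordinates `Φ`, of the right-invariant vector field `(R_g)_* X`. -/
def rightField {ι : Type} [Fintype ι] (Φ : (ι → ℝ) → G) (x : ι → ℝ)
    (X : GroupLieAlgebra 𝓘(ℝ, E) G) : ι → ℝ :=
  (rightForm (E := E) Φ x).inverse X

/-- The covector on the Lie algebra obtained from the cotangent vector with components `p i` at
the point with coordinates `x i` by right translation to the unit. -/
def rightMoment {ι : Type} [Fintype ι] (Φ : (ι → ℝ) → G) (z : ι ⊕ ι → ℝ) :
    Module.Dual ℝ (GroupLieAlgebra 𝓘(ℝ, E) G) :=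
  (∑ i, z (Sum.inr i) • (LinearMap.proj i : (ι → ℝ) →ₗ[ℝ] ℝ)) ∘ₗ
    ((rightForm (E := E) Φ (fun i => z (Sum.inl i))).inverse).toLinearMap

/-- The quadratic form on the dual of the Lie algebra inverse to the nondegenerate form `B`. -/
def inverseForm [FiniteDimensional ℝ E] (B : LinearMap.BilinForm ℝ (GroupLieAlgebra 𝓘(ℝ, E) G))
    (hB : B.Nondegenerate) (lam : Module.Dual ℝ (GroupLieAlgebra 𝓘(ℝ, E) G)) : ℝ :=
  lam ((B.toDual hB).symm lam)

/-- `φ` is a local coordinate system on `G`: a diffeomorphism of an open subset of `G` onto an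
open subset of `ℝⁿ`. -/
def IsLocalCoordinates {n : ℕ} (E : Type*) [NormedAddCommGroup E] [NormedSpace ℝ E]
    {G : Type*} [TopologicalSpace G] [ChartedSpace E G]
    (φ : OpenPartialHomeomorph G (Fin n → ℝ)) : Prop :=
  ContMDiffOn 𝓘(ℝ, E) 𝓘(ℝ, Fin n → ℝ) ∞ φ φ.source ∧
    ContMDiffOn 𝓘(ℝ, Fin n → ℝ) 𝓘(ℝ, E) ∞ φ.symm φ.target

/-- The geodesic Hamiltonian `H = |p|² / 2` of the right-invariant metric with the value `B` at
the unit. -/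
def geodesicHam [FiniteDimensional ℝ E] {n : ℕ} (B : LinearMap.BilinForm ℝ (GroupLieAlgebra 𝓘(ℝ, E) G))
    (hB : B.Nondegenerate) (φ : OpenPartialHomeomorph G (Fin n → ℝ))
    (z : Fin n ⊕ Fin n → ℝ) : ℝ :=
  inverseForm B hB (rightMoment φ.symm z) / 2

/-- The components of the right-invariant 2-form on `G` with the value `F` at the unit. -/
def faraday {n : ℕ} (F : LinearMap.BilinForm ℝ (GroupLieAlgebra 𝓘(ℝ, E) G))
    (φ : OpenPartialHomeomorph G (Fin n → ℝ)) (x : Fin n → ℝ) (i j : Fin n) : ℝ :=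
  F (rightForm φ.symm x (Pi.single i 1)) (rightForm φ.symm x (Pi.single j 1))

/-- The right-invariant magnetic geodesic flow on `G`, in local coordinates. -/
def magneticGeodesicField [FiniteDimensional ℝ E] {n : ℕ}
    (B : LinearMap.BilinForm ℝ (GroupLieAlgebra 𝓘(ℝ, E) G)) (hB : B.Nondegenerate)
    (F : LinearMap.BilinForm ℝ (GroupLieAlgebra 𝓘(ℝ, E) G)) (e : ℝ)
    (φ : OpenPartialHomeomorph G (Fin n → ℝ)) :
    (Fin n ⊕ Fin n → ℝ) → Fin n ⊕ Fin n → ℝ :=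
  magField e (faraday F φ) (geodesicHam B hB φ)

/-! ### The central extension -/

/-- `Ge` is a Lie group with the Lie algebra `𝔤 ⊕ ℝ Z`, `[X, Y]_F = [X, Y] + F(X, Y) Z`, that
extends `G`: it projects onto `G`, the kernel of the projection has the Lie algebra `ℝ Z`, and the
one-parameter subgroup `T = exp(ℝ Z)` (which is the unit component of that kernel) is central.
The map `lift` is the inclusion of the first summand into `𝔤 ⊕ ℝ Z`. -/
structure CentralExtension (F : LinearMap.BilinForm ℝ (GroupLieAlgebra 𝓘(ℝ, E) G))
    (Ee : Type*) [NormedAddCommGroup Ee] [NormedSpace ℝ Ee]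
    (Ge : Type*) [TopologicalSpace Ge] [ChartedSpace Ee Ge] [Group Ge] where
  proj : Ge →* G
  proj_smooth : ContMDiff 𝓘(ℝ, Ee) 𝓘(ℝ, E) ∞ proj
  proj_surjective : Function.Surjective proj
  /-- The central element `Z` of the Lie algebra. -/
  Z : GroupLieAlgebra 𝓘(ℝ, Ee) Ge
  /-- The one-parameter subgroup `t ↦ exp (t Z)`. -/
  fiber : ℝ → Ge
  fiber_smooth : ContMDiff 𝓘(ℝ, ℝ) 𝓘(ℝ, Ee) ∞ fiber
  fiber_zero : fiber 0 = 1
  fiber_add : ∀ s t, fiber (s + t) = fiber s * fiber t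
  fiber_deriv : (mfderiv 𝓘(ℝ, ℝ) 𝓘(ℝ, Ee) fiber 0 : ℝ →L[ℝ] Ee) 1 = Z
  fiber_central : ∀ t g, fiber t * g = g * fiber t
  proj_fiber : ∀ t, proj (fiber t) = 1
  lift : GroupLieAlgebra 𝓘(ℝ, E) G →ₗ[ℝ] GroupLieAlgebra 𝓘(ℝ, Ee) Ge
  proj_lift : ∀ X, (mfderiv 𝓘(ℝ, Ee) 𝓘(ℝ, E) proj 1 : Ee →L[ℝ] E) (lift X) = X
  Z_ne_zero : Z ≠ 0
  proj_ker : ∀ Y : GroupLieAlgebra 𝓘(ℝ, Ee) Ge,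
    (mfderiv 𝓘(ℝ, Ee) 𝓘(ℝ, E) proj 1 : Ee →L[ℝ] E) Y = 0 ↔ ∃ c : ℝ, Y = c • Z
  lie_lift : ∀ X Y, ⁅lift X, lift Y⁆ = lift ⁅X, Y⁆ + F X Y • Z

namespace CentralExtension

variable {F : LinearMap.BilinForm ℝ (GroupLieAlgebra 𝓘(ℝ, E) G)}
  {Ee : Type*} [NormedAddCommGroup Ee] [NormedSpace ℝ Ee]
  {Ge : Type*} [TopologicalSpace Ge] [ChartedSpace Ee Ge] [Group Ge]

/-- `s` is a smooth section of the projection over the open part `W` of the coordinate domain. -/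
def IsLocalSection (ext : CentralExtension F Ee Ge) {n : ℕ} (φ : OpenPartialHomeomorph G (Fin n → ℝ))
    (W : Set (Fin n → ℝ)) (s : (Fin n → ℝ) → Ge) : Prop :=
  IsOpen W ∧ W ⊆ φ.target ∧ ContMDiffOn 𝓘(ℝ, Fin n → ℝ) 𝓘(ℝ, Ee) ∞ s W ∧
    ∀ x ∈ W, ext.proj (s x) = φ.symm x

/-- The local coordinates `(g⁰, gⁱ)` on `Ge` defined by a section `s`: the point with these
coordinates is `s(g) exp(g⁰ Z)`. The index `none` stands for `0`. -/
def coords (ext : CentralExtension F Ee Ge) {n : ℕ} (s : (Fin n → ℝ) → Ge)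
    (y : Option (Fin n) → ℝ) : Ge :=
  s (fun i => y (some i)) * ext.fiber (y none)

/-- The Hamiltonian `B̃(p, p) / 2` on the cotangent bundle of `Ge`, where `B̃` is the right-invariant
form on covectors whose value at the unit is the pull-back of the inverse of `B` along the
restriction of covectors from `𝔤 ⊕ ℝ Z` to `𝔤`. -/
def extHam [FiniteDimensional ℝ E] (ext : CentralExtension F Ee Ge) {n : ℕ}
    (B : LinearMap.BilinForm ℝ (GroupLieAlgebra 𝓘(ℝ, E) G)) (hB : B.Nondegenerate)
    (s : (Fin n → ℝ) → Ge) (w : Option (Fin n) ⊕ Option (Fin n) → ℝ) : ℝ :=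
  inverseForm B hB (rightMoment (ext.coords s) w ∘ₗ ext.lift) / 2

/-- The point of the cotangent bundle of `Ge` with the coordinates `g⁰`, `gⁱ` and the momenta
`p₀ = -e`, `pᵢ`. -/
def levelPoint {n : ℕ} (e g0 : ℝ) (z : Fin n ⊕ Fin n → ℝ) :
    Option (Fin n) ⊕ Option (Fin n) → ℝ
  | Sum.inl none => g0
  | Sum.inl (some i) => z (Sum.inl i)
  | Sum.inr none => -e
  | Sum.inr (some i) => z (Sum.inr i)

/-- The subsystem `ġⁱ = ∂H̃/∂pᵢ`, `ṗᵢ = -∂H̃/∂gⁱ` at the level `p₀ = -e` (where the right-hand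
side, which does not depend on `g⁰`, is taken at `g⁰ = 0`). -/
def reducedField [FiniteDimensional ℝ E] (ext : CentralExtension F Ee Ge) {n : ℕ}
    (B : LinearMap.BilinForm ℝ (GroupLieAlgebra 𝓘(ℝ, E) G)) (hB : B.Nondegenerate) (e : ℝ)
    (s : (Fin n → ℝ) → Ge) (z : Fin n ⊕ Fin n → ℝ) : Fin n ⊕ Fin n → ℝ
  | Sum.inl i => hamField (ext.extHam B hB s) (levelPoint e 0 z) (Sum.inl (some i))
  | Sum.inr i => hamField (ext.extHam B hB s) (levelPoint e 0 z) (Sum.inr (some i))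

/-- The vector potential given by the section `s`: `Aᵢ = -η̃⁰(σᵢ)`, where `η̃⁰(X)` is the
component along `∂/∂g⁰` of the right-invariant vector field `η̃_X = -(R_g)_* X` on `Ge`, and
`σ = -(R_{g⁻¹})_*` is the right-invariant form on `G` dual to the fields `η_X`. -/
def vectorPotential (ext : CentralExtension F Ee Ge) {n : ℕ}
    (φ : OpenPartialHomeomorph G (Fin n → ℝ)) (s : (Fin n → ℝ) → Ge)
    (x : Fin n → ℝ) (i : Fin n) : ℝ :=
  - (-(rightField (ext.coords s) (fun o => o.elim 0 x)
      (ext.lift (-(rightForm φ.symm x (Pi.single i 1)))) none))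

/-- The system on the central extension at the level `p₀ = -e`, over the domain of the local
coordinates `φ` on `G`, is integrable in quadratures: it is so in the local coordinates
`(g⁰, gⁱ)` given by any local section of the extension. -/
def ReducedFlowIntegrable [FiniteDimensional ℝ E] (ext : CentralExtension F Ee Ge) {n : ℕ}
    (B : LinearMap.BilinForm ℝ (GroupLieAlgebra 𝓘(ℝ, E) G)) (hB : B.Nondegenerate) (e : ℝ)
    (φ : OpenPartialHomeomorph G (Fin n → ℝ)) : Prop :=
  ∀ (W : Set (Fin n → ℝ)) (s : (Fin n → ℝ) → Ge), ext.IsLocalSection φ W s →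
    IntegrableInQuadratures (phaseDomain W) (ext.reducedField B hB e s)

end CentralExtension

end LieGroup

end MagneticFlow

end

/-! Everything is read off from the right logarithmic derivative θ = dΦ·Φ⁻¹ of a parametrization
(`logDeriv`). For a section s over the coordinates φ, the differential of the projection kills only
ℝZ, so θ_s = lift θ_φ + A ⊗ Z, and the coefficient A is the vector potential (`logDeriv_eq`).
Comparing the Maurer–Cartan equations of the two groups (`fderiv_logDeriv_sub`), the bracket of two
lifted vectors has the extra component F along Z, whence dA = F (`curl_vectorPotential`). In the
coordinates (g⁰, gⁱ) the lift of a right-invariant vector with components u is (-A(u), u), so the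
Hamiltonian of the extension is H(x, p - p₀A) (`extHam_eq`). It does not contain g⁰, and at p₀ = -e
it is H composed with the momentum shift by eA. Such a shift turns the canonical equations into the
magnetic ones, the curl of A appearing as the extra force (`fderiv_momentumShift_hamField`). This is
part (ii).

For part (i), a conjugacy transfers solutions by quadratures once its components are known functions
(`HasQuadSolution.of_conj`). The question is therefore whether eA is known from the right-hand side
of the system to be solved.

If that system is the reduced one, its velocity is M(p + eA), with M the metric on covectors.
Differentiation in p gives M, and inverting M gives eA (`Quad.vectorPotential`).

If it is the magnetic one, only M and eF are visible (`Quad.magneticField`), and F determines A only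
up to a gradient; the potential of an arbitrary section need not be accessible. The hypothesis,
however, covers every section, and multiplying s by exp(-hZ) subtracts dh from A
(`vectorPotential_mul_fiber`). With h the integral of A along rays, the new potential is the
Poincaré primitive of F (`sub_pd_radialGauge`), which is a quadrature (`Quad.radial_integral`). -/

noncomputable section

namespace MagneticFlow

open Filter Topology VectorField

/-! ### Differentials as linear maps of the model spaces -/

/-- The derivative of a map between manifolds, as a linear map between the model spaces. -/
def modelDeriv (E E' : Type*) [NormedAddCommGroup E] [NormedSpace ℝ E] [NormedAddCommGroup E']
    [NormedSpace ℝ E'] {M M' : Type*} [TopologicalSpace M] [ChartedSpace E M]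
    [TopologicalSpace M'] [ChartedSpace E' M'] (f : M → M') (x : M) : E →L[ℝ] E' :=
  mfderiv 𝓘(ℝ, E) 𝓘(ℝ, E') f x

section ModelDeriv

variable {E E' E'' : Type*} [NormedAddCommGroup E] [NormedSpace ℝ E] [NormedAddCommGroup E']
  [NormedSpace ℝ E'] [NormedAddCommGroup E''] [NormedSpace ℝ E'']
  {M M' M'' : Type*} [TopologicalSpace M] [ChartedSpace E M]
  [TopologicalSpace M'] [ChartedSpace E' M'] [TopologicalSpace M''] [ChartedSpace E'' M'']

theorem modelDeriv_comp {g : M' → M''} {f : M → M'} (x : M)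
    (hg : MDifferentiableAt 𝓘(ℝ, E') 𝓘(ℝ, E'') g (f x))
    (hf : MDifferentiableAt 𝓘(ℝ, E) 𝓘(ℝ, E') f x) :
    modelDeriv E E'' (fun y => g (f y)) x =
      (modelDeriv E' E'' g (f x)).comp (modelDeriv E E' f x) :=
  mfderiv_comp x hg hf

theorem modelDeriv_congr {f g : M → M'} {x : M} (h : f =ᶠ[𝓝 x] g) :
    modelDeriv E E' f x = modelDeriv E E' g x :=
  h.mfderiv_eq

theorem modelDeriv_id (x : M) : modelDeriv E E (fun y : M => y) x = ContinuousLinearMap.id ℝ E :=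
  mfderiv_id

theorem modelDeriv_eq_fderiv (f : E → E') (x : E) : modelDeriv E E' f x = fderiv ℝ f x :=
  mfderiv_eq_fderiv

theorem modelDeriv_const (c : M') (x : M) : modelDeriv E E' (fun _ : M => c) x = 0 :=
  mfderiv_const

end ModelDeriv

/-! ### Right logarithmic derivatives and the Maurer–Cartan equation -/

section RightForm

variable {E : Type*} [NormedAddCommGroup E] [NormedSpace ℝ E]
  {G : Type*} [TopologicalSpace G] [ChartedSpace E G] [Group G]
  {ι κ : Type} [Fintype ι] [Fintype κ]

/-- The right logarithmic derivative of `Φ`, with values in the model space. -/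
def logDeriv (E : Type*) [NormedAddCommGroup E] [NormedSpace ℝ E] {G : Type*} [TopologicalSpace G]
    [ChartedSpace E G] [Group G] (Φ : (ι → ℝ) → G) (x : ι → ℝ) : (ι → ℝ) →L[ℝ] E :=
  modelDeriv (ι → ℝ) E (fun y => Φ y * (Φ x)⁻¹) x

theorem logDeriv_congr {Φ Ψ : (ι → ℝ) → G} {x : ι → ℝ} (h : Φ =ᶠ[𝓝 x] Ψ) :
    logDeriv E Φ x = logDeriv E Ψ x := by
  apply modelDeriv_congr
  filter_upwards [h] with y hy
  rw [hy, h.self_of_nhds]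

theorem logDeriv_mul_const (Φ : (ι → ℝ) → G) (g : G) (x : ι → ℝ) :
    logDeriv E (fun y => Φ y * g) x = logDeriv E Φ x := by
  simp [logDeriv, mul_assoc]

variable [LieGroup 𝓘(ℝ, E) ∞ G]

theorem mdifferentiableAt_mul_right (g h : G) :
    MDifferentiableAt 𝓘(ℝ, E) 𝓘(ℝ, E) (fun a : G => a * g) h :=
  (contMDiff_mul_right (I := 𝓘(ℝ, E)) (n := ∞)).contMDiffAt.mdifferentiableAt (by simp)

theorem mdifferentiableAt_mul_left (g h : G) :
    MDifferentiableAt 𝓘(ℝ, E) 𝓘(ℝ, E) (fun a : G => g * a) h :=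
  (contMDiff_mul_left (I := 𝓘(ℝ, E)) (n := ∞)).contMDiffAt.mdifferentiableAt (by simp)

theorem mdifferentiableAt_translate {Φ : (ι → ℝ) → G} {x : ι → ℝ}
    (hΦ : MDifferentiableAt 𝓘(ℝ, ι → ℝ) 𝓘(ℝ, E) Φ x) (g : G) :
    MDifferentiableAt 𝓘(ℝ, ι → ℝ) 𝓘(ℝ, E) (fun y => Φ y * g) x :=
  (mdifferentiableAt_mul_right g (Φ x)).comp x hΦ

/-- The translated map sends x to the unit, so the one fixed chart at the unit computes the
derivative for every x. This reduces smoothness in x to calculus in vector spaces. -/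
theorem logDeriv_eq_fderiv {Φ : (ι → ℝ) → G} {x : ι → ℝ}
    (hΦ : MDifferentiableAt 𝓘(ℝ, ι → ℝ) 𝓘(ℝ, E) Φ x) :
    logDeriv E Φ x =
      fderiv ℝ (fun y => extChartAt 𝓘(ℝ, E) (1 : G) (Φ y * (Φ x)⁻¹)) x := by
  refine (if_pos (mdifferentiableAt_translate hΦ (Φ x)⁻¹)).trans ?_
  simp [writtenInExtChartAt, Function.comp_def, chartAt_self_eq]

theorem logDeriv_comp {Φ : (ι → ℝ) → G} {f : (κ → ℝ) → ι → ℝ} {x : κ → ℝ}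
    (hΦ : MDifferentiableAt 𝓘(ℝ, ι → ℝ) 𝓘(ℝ, E) Φ (f x)) (hf : DifferentiableAt ℝ f x) :
    logDeriv E (fun y => Φ (f y)) x = (logDeriv E Φ (f x)).comp (fderiv ℝ f x) := by
  rw [← modelDeriv_eq_fderiv]
  exact modelDeriv_comp x (mdifferentiableAt_translate hΦ (Φ (f x))⁻¹) hf.mdifferentiableAt

theorem logDeriv_map {E' : Type*} [NormedAddCommGroup E'] [NormedSpace ℝ E']
    {G' : Type*} [TopologicalSpace G'] [ChartedSpace E' G'] [Group G']
    (p : G →* G') (hp : MDifferentiableAt 𝓘(ℝ, E) 𝓘(ℝ, E') p 1) {Φ : (ι → ℝ) → G} {x : ι → ℝ}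
    (hΦ : MDifferentiableAt 𝓘(ℝ, ι → ℝ) 𝓘(ℝ, E) Φ x) :
    logDeriv E' (fun y => p (Φ y)) x = (modelDeriv E E' p 1).comp (logDeriv E Φ x) := by
  have h2 : (fun y => p (Φ y) * (p (Φ x))⁻¹) = fun y => p (Φ y * (Φ x)⁻¹) := by
    ext y; simp
  rw [logDeriv, h2, modelDeriv_comp x (E' := E) (by rwa [mul_inv_cancel])
    (mdifferentiableAt_translate hΦ (Φ x)⁻¹), mul_inv_cancel, logDeriv]

/-- In the chart at the unit, (x, y) ↦ Φ(y)Φ(x)⁻¹ is jointly smooth near the diagonal, and θ is its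
partial derivative in y on the diagonal. -/
theorem contDiffOn_logDeriv {Φ : (ι → ℝ) → G} {U : Set (ι → ℝ)} (hU : IsOpen U)
    (hΦ : ContMDiffOn 𝓘(ℝ, ι → ℝ) 𝓘(ℝ, E) ∞ Φ U) :
    ContDiffOn ℝ ∞ (logDeriv E Φ) U := by
  intro x hx
  have hΦx : ∀ y ∈ U, ContMDiffAt 𝓘(ℝ, ι → ℝ) 𝓘(ℝ, E) ∞ Φ y := fun y hy =>
    hΦ.contMDiffAt (hU.mem_nhds hy)
  have hK : ContDiffAt ℝ ∞ (Function.uncurry fun x y : ι → ℝ =>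
      extChartAt 𝓘(ℝ, E) (1 : G) (Φ y * (Φ x)⁻¹)) (x, id x) := by
    rw [← contMDiffAt_iff_contDiffAt]
    have h1 : ContMDiffAt 𝓘(ℝ, (ι → ℝ) × (ι → ℝ)) 𝓘(ℝ, E) ∞
        (fun z : (ι → ℝ) × (ι → ℝ) => Φ z.2 * (Φ z.1)⁻¹) (x, x) := by
      have a : ContMDiffAt 𝓘(ℝ, (ι → ℝ) × (ι → ℝ)) 𝓘(ℝ, E) ∞
        (fun z : (ι → ℝ) × (ι → ℝ) => Φ z.2) (x, x) :=
        (hΦx x hx).comp (x, x) (contDiff_snd.contMDiff.contMDiffAt)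
      have b : ContMDiffAt 𝓘(ℝ, (ι → ℝ) × (ι → ℝ)) 𝓘(ℝ, E) ∞
        (fun z : (ι → ℝ) × (ι → ℝ) => Φ z.1) (x, x) :=
        (hΦx x hx).comp (x, x) (contDiff_fst.contMDiff.contMDiffAt)
      exact a.mul b.inv
    have h2 : ContMDiffAt 𝓘(ℝ, E) 𝓘(ℝ, E) ∞ (extChartAt 𝓘(ℝ, E) (1 : G)) (Φ x * (Φ x)⁻¹) := by
      have : IsManifold 𝓘(ℝ, E) ∞ G := LieGroup.toContMDiffMul.toIsManifold
      rw [mul_inv_cancel]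
      exact contMDiffAt_extChartAt
    exact h2.comp (x, x) h1
  have := (hK.fderiv (m := ∞) contDiffAt_id (by simp)).congr_of_eventuallyEq
    (f₁ := logDeriv E Φ) (by
      filter_upwards [hU.mem_nhds hx] with y hy
      rw [logDeriv_eq_fderiv ((hΦx y hy).mdifferentiableAt (by simp))]
      rfl)
  exact this.contDiffWithinAt

/-- The product rule. -/
theorem modelDeriv_mul {E' M : Type*} [NormedAddCommGroup E'] [NormedSpace ℝ E']
    [TopologicalSpace M] [ChartedSpace E' M] {f g : M → G} {x : M}
    (hf : MDifferentiableAt 𝓘(ℝ, E') 𝓘(ℝ, E) f x) (hg : MDifferentiableAt 𝓘(ℝ, E') 𝓘(ℝ, E) g x) :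
    modelDeriv E' E (fun y => f y * g y) x =
      (modelDeriv E E (fun a => a * g x) (f x)).comp (modelDeriv E' E f x) +
      (modelDeriv E E (fun a => f x * a) (g x)).comp (modelDeriv E' E g x) := by
  have hm : MDifferentiableAt (𝓘(ℝ, E).prod 𝓘(ℝ, E)) 𝓘(ℝ, E) (fun p : G × G => p.1 * p.2)
      (f x, g x) := (contMDiff_mul 𝓘(ℝ, E) ∞).mdifferentiableAt (by simp)
  ext v
  have h1 := mfderiv_comp_apply (x := x) hm (hf.prodMk hg) v
  have h2 := mfderiv_prod_eq_add_apply (v := mfderiv 𝓘(ℝ, E') (𝓘(ℝ, E).prod 𝓘(ℝ, E))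
    (fun y => (f y, g y)) x v) hm
  refine h1.trans (h2.trans ?_)
  rw [hf.mfderiv_prod hg]
  rfl

/-- The derivative of the inversion at the unit is `-1`. -/
theorem modelDeriv_inv_one :
    modelDeriv E E (fun g : G => g⁻¹) 1 = -ContinuousLinearMap.id ℝ E := by
  have hi : MDifferentiableAt 𝓘(ℝ, E) 𝓘(ℝ, E) (fun g : G => g⁻¹) 1 :=
    (contMDiff_inv 𝓘(ℝ, E) ∞).mdifferentiableAt (by simp)
  have h1 := modelDeriv_mul (E := E) (x := (1 : G)) mdifferentiableAt_id hi
  simp only [id, mul_inv_cancel, modelDeriv_const, inv_one, mul_one, one_mul, modelDeriv_id,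
    ContinuousLinearMap.id_comp, show modelDeriv E E id (1 : G) = .id ℝ E from modelDeriv_id 1] at h1
  exact eq_neg_of_add_eq_zero_right h1.symm

/-- The derivative of `x ↦ (Φ x)⁻¹`. -/
theorem modelDeriv_inv_comp {Φ : (ι → ℝ) → G} {x : ι → ℝ}
    (hΦ : MDifferentiableAt 𝓘(ℝ, ι → ℝ) 𝓘(ℝ, E) Φ x) :
    modelDeriv (ι → ℝ) E (fun y => (Φ y)⁻¹) x =
      -(modelDeriv E E (fun a : G => (Φ x)⁻¹ * a) 1).comp (logDeriv E Φ x) := by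
  have hi : MDifferentiableAt 𝓘(ℝ, E) 𝓘(ℝ, E) (fun g : G => g⁻¹) (Φ x * (Φ x)⁻¹) :=
    (contMDiff_inv 𝓘(ℝ, E) ∞).mdifferentiableAt (by simp)
  -- This factorization needs the derivative of the inversion at the unit only.
  have h : (fun y => (Φ y)⁻¹) = fun y => (Φ x)⁻¹ * (Φ y * (Φ x)⁻¹)⁻¹ := by
    ext y; simp
  have h3 := modelDeriv_comp x hi (mdifferentiableAt_translate hΦ (Φ x)⁻¹)
  have h4 : MDifferentiableAt 𝓘(ℝ, ι → ℝ) 𝓘(ℝ, E) (fun y => (Φ y * (Φ x)⁻¹)⁻¹) x :=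
    hi.comp x (mdifferentiableAt_translate hΦ (Φ x)⁻¹)
  rw [h, modelDeriv_comp x (mdifferentiableAt_mul_left _ _) h4, h3]
  simp only [mul_inv_cancel, inv_one, modelDeriv_inv_one, logDeriv]
  ext v
  simp

theorem isInvertible_modelDeriv_mul_left (g : G) :
    (modelDeriv E E (fun a : G => g * a) 1).IsInvertible := by
  have h1 := modelDeriv_comp (1 : G) (mdifferentiableAt_mul_left (E := E) g⁻¹ (g * 1))
    (mdifferentiableAt_mul_left g 1)
  have h2 := modelDeriv_comp (g * 1) (mdifferentiableAt_mul_left (E := E) g (g⁻¹ * (g * 1)))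
    (mdifferentiableAt_mul_left g⁻¹ (g * 1))
  simp only [inv_mul_cancel_left, mul_inv_cancel_left, modelDeriv_id] at h1 h2
  exact ContinuousLinearMap.IsInvertible.of_inverse h2.symm h1.symm

theorem mlieBracket_eq_lieBracket (V W : E → E) (x : E) :
    mlieBracket 𝓘(ℝ, E) V W x = lieBracket ℝ V W x := by
  have := congrFun (mlieBracketWithin_eq_lieBracketWithin (𝕜 := ℝ) (E := E) (V := V) (W := W)
    (s := univ)) x
  exact (congrFun (mlieBracketWithin_univ (I := 𝓘(ℝ, E)) (V := V) (W := W)) x).symm.trans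
    (this.trans (congrFun lieBracketWithin_univ x))

/-- The Lie bracket is defined by left-invariant fields, while θ is built from right translations;
the inversion passes from one to the other. The left translation by Φ(x)⁻¹ occurs both in the field
and in the differential of Φ⁻¹ and cancels, which leaves -θ⁻¹v. -/
theorem mpullback_inv_mulInvariantVectorField {Φ : (ι → ℝ) → G} {x : ι → ℝ}
    (hΦ : MDifferentiableAt 𝓘(ℝ, ι → ℝ) 𝓘(ℝ, E) Φ x) (hi : (logDeriv E Φ x).IsInvertible)
    (v : E) :
    (mpullback 𝓘(ℝ, ι → ℝ) 𝓘(ℝ, E) (fun y => (Φ y)⁻¹)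
      (mulInvariantVectorField (v : GroupLieAlgebra 𝓘(ℝ, E) G)) x : ι → ℝ) =
      -(logDeriv E Φ x).inverse v := by
  change (modelDeriv (ι → ℝ) E (fun y => (Φ y)⁻¹) x).inverse
    (modelDeriv E E (fun a : G => (Φ x)⁻¹ * a) 1 v) = _
  have hD : (modelDeriv (ι → ℝ) E (fun y => (Φ y)⁻¹) x).IsInvertible := by
    rw [modelDeriv_inv_comp hΦ]
    obtain ⟨e, he⟩ := (isInvertible_modelDeriv_mul_left (E := E) (Φ x)⁻¹).comp hi
    exact ⟨e.trans (ContinuousLinearEquiv.neg ℝ), by rw [← he]; ext; simp⟩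
  rw [hD.inverse_apply_eq, modelDeriv_inv_comp hΦ]
  simp [hi.self_apply_inverse]

variable [CompleteSpace E]

variable (E G) in
/-- The bracket of the Lie algebra of `G`, as an operation on the model space. -/
def modelBracket (a b : GroupLieAlgebra 𝓘(ℝ, E) G) : E := (⁅a, b⁆ : GroupLieAlgebra 𝓘(ℝ, E) G)

/-- The Maurer–Cartan equation. -/
theorem fderiv_logDeriv_sub {Φ : (ι → ℝ) → G} {U : Set (ι → ℝ)} (hU : IsOpen U)
    (hΦ : ContMDiffOn 𝓘(ℝ, ι → ℝ) 𝓘(ℝ, E) ∞ Φ U)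
    (hi : ∀ x ∈ U, (logDeriv E Φ x).IsInvertible) {x : ι → ℝ} (hx : x ∈ U) (u w : ι → ℝ) :
    fderiv ℝ (logDeriv E Φ) x u w - fderiv ℝ (logDeriv E Φ) x w u =
      modelBracket E G (logDeriv E Φ x u) (logDeriv E Φ x w) := by
  have : LieGroup 𝓘(ℝ, E) (minSmoothness ℝ 3) G := by
    rw [minSmoothness_of_isRCLikeNormedField]; infer_instance
  have hΦx : ∀ y ∈ U, ContMDiffAt 𝓘(ℝ, ι → ℝ) 𝓘(ℝ, E) ∞ Φ y := fun y hy =>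
    hΦ.contMDiffAt (hU.mem_nhds hy)
  set θ := logDeriv E Φ with hθ
  have hθd : DifferentiableAt ℝ θ x :=
    ((contDiffOn_logDeriv hU hΦ).contDiffAt (hU.mem_nhds hx)).differentiableAt (by simp)
  let V : E → (ι → ℝ) → (ι → ℝ) := fun v y => -(θ y).inverse v
  have hVd : ∀ v, DifferentiableAt ℝ (V v) x := by
    intro v
    have h1 : DifferentiableAt ℝ (fun y => (θ y).inverse) x :=
      ((hi x hx).contDiffAt_map_inverse (n := 1)).differentiableAt (by simp) |>.comp x hθd
    exact (h1.clm_apply (differentiableAt_const v)).neg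
  have hV : ∀ v : E, mpullback 𝓘(ℝ, ι → ℝ) 𝓘(ℝ, E) (fun y => (Φ y)⁻¹)
      (mulInvariantVectorField (v : GroupLieAlgebra 𝓘(ℝ, E) G))
        =ᶠ[𝓝 x] V v := by
    intro v
    filter_upwards [hU.mem_nhds hx] with y hy
    exact mpullback_inv_mulInvariantVectorField ((hΦx y hy).mdifferentiableAt (by simp)) (hi y hy) v
  have hbr : ∀ v v' : E, V (modelBracket E G v v') x = lieBracket ℝ (V v) (V v') x := by
    intro v v'
    have h1 := mpullback_mlieBracket (I := 𝓘(ℝ, ι → ℝ)) (I' := 𝓘(ℝ, E)) (n := ∞)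
      (f := fun y => (Φ y)⁻¹) (x₀ := x)
      (mdifferentiableAt_mulInvariantVectorField (v : GroupLieAlgebra 𝓘(ℝ, E) G))
      (mdifferentiableAt_mulInvariantVectorField (v' : GroupLieAlgebra 𝓘(ℝ, E) G))
      (hΦx x hx).inv (by rw [minSmoothness_of_isRCLikeNormedField]; exact ENat.LEInfty.out)
    have h0 := mulInvariantVector_mlieBracket (I := 𝓘(ℝ, E)) (G := G) v v'
    have h2 := (hV (modelBracket E G v v')).self_of_nhds
    rw [← h2]
    refine ((congrArg (fun X => mpullback 𝓘(ℝ, ι → ℝ) 𝓘(ℝ, E) (fun y => (Φ y)⁻¹) X x) h0).trans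
      h1).trans ?_
    exact ((hV v).mlieBracket_vectorField_eq (hV v')).trans (mlieBracket_eq_lieBracket _ _ x)
  -- This is the derivative of the identity θ(V v) = -v in the direction a. It trades derivatives of
  -- V for derivatives of θ.
  have hder : ∀ v a, fderiv ℝ θ x a (V v x) + θ x (fderiv ℝ (V v) x a) = 0 := by
    intro v a
    have h1 : HasFDerivAt (fun y => θ y (V v y)) _ x := hθd.hasFDerivAt.clm_apply (hVd v).hasFDerivAt
    have h2 : (fun y => θ y (V v y)) =ᶠ[𝓝 x] fun _ => -v := by
      filter_upwards [hU.mem_nhds hx] with y hy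
      simp [V, (hi y hy).self_apply_inverse]
    have h3 := h1.unique ((hasFDerivAt_const (-v) x).congr_of_eventuallyEq h2)
    have h4 := congrArg (fun L => L a) h3
    simpa [add_comm] using h4
  have hVθ : ∀ a, V (θ x a) x = -a := fun a => by simp [V, (hi x hx).inverse_apply_self]
  -- With v = θu and v' = θw the fields V take the values -u and -w at x, so the bracket identity
  -- becomes the antisymmetrized derivative of θ.
  have key := congrArg (θ x) (hbr (θ x u) (θ x w))
  have h1 := hder (θ x u) w
  have h2 := hder (θ x w) u
  simp only [lieBracket, hVθ, map_neg, map_sub] at key h1 h2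
  rw [show θ x (V (modelBracket E G (θ x u) (θ x w)) x) = -modelBracket E G (θ x u) (θ x w) by
    simp only [V, map_neg, (hi x hx).self_apply_inverse]] at key
  rw [neg_add_eq_zero] at h1 h2
  rw [← h1, ← h2] at key
  rw [← neg_inj, key]
  abel

end RightForm

theorem pd_eq {ι : Type} [Fintype ι] [DecidableEq ι] (i : ι) (f : (ι → ℝ) → ℝ) (x : ι → ℝ) :
    pd i f x = fderiv ℝ f x (Pi.single i 1) := by
  unfold pd
  congr!

/-! ### Local sections of the extension: vector potential, curl and Hamiltonian -/

section Extension

variable {E : Type*} [NormedAddCommGroup E] [NormedSpace ℝ E]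
  {G : Type*} [TopologicalSpace G] [ChartedSpace E G] [Group G] [LieGroup 𝓘(ℝ, E) ∞ G]
  {n : ℕ}

namespace IsLocalCoordinates

variable {φ : OpenPartialHomeomorph G (Fin n → ℝ)} {x : Fin n → ℝ}

omit [Group G] [LieGroup 𝓘(ℝ, E) ∞ G] in
theorem mdifferentiableAt_symm (hφ : IsLocalCoordinates E φ) (hx : x ∈ φ.target) :
    MDifferentiableAt 𝓘(ℝ, Fin n → ℝ) 𝓘(ℝ, E) φ.symm x :=
  (hφ.2.contMDiffAt (φ.open_target.mem_nhds hx)).mdifferentiableAt (by simp)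

/-- The inverse is the differential at the unit of z ↦ φ(z·a), with a the point that has the
coordinates x. -/
theorem isInvertible_logDeriv (hφ : IsLocalCoordinates E φ) (hx : x ∈ φ.target) :
    (logDeriv E φ.symm x).IsInvertible := by
  set a := φ.symm x with ha
  have has : a ∈ φ.source := φ.map_target hx
  have hf := mdifferentiableAt_translate (hφ.mdifferentiableAt_symm hx) a⁻¹
  have hφd : MDifferentiableAt 𝓘(ℝ, E) 𝓘(ℝ, Fin n → ℝ) φ (1 * a) := by
    rw [one_mul]
    exact (hφ.1.contMDiffAt (φ.open_source.mem_nhds has)).mdifferentiableAt (by simp)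
  have hg : MDifferentiableAt 𝓘(ℝ, E) 𝓘(ℝ, Fin n → ℝ) (fun z => φ (z * a)) 1 :=
    hφd.comp 1 (mdifferentiableAt_mul_right a 1)
  have hfx : φ.symm x * a⁻¹ = 1 := by simp [ha]
  have h1 := modelDeriv_comp x (g := fun z => φ (z * a)) (f := fun y => φ.symm y * a⁻¹)
    (by rw [hfx]; exact hg) hf
  have h2 := modelDeriv_comp (1 : G) (g := fun y => φ.symm y * a⁻¹) (f := fun z => φ (z * a))
    (by simpa [ha, hx] using hf) hg
  have e1 : modelDeriv (Fin n → ℝ) (Fin n → ℝ) (fun y => φ (φ.symm y * a⁻¹ * a)) x = .id ℝ _ := by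
    rw [← modelDeriv_id x]
    apply modelDeriv_congr
    filter_upwards [φ.open_target.mem_nhds hx] with y hy
    simp [hy]
  have e2 : modelDeriv E E (fun z : G => φ.symm (φ (z * a)) * a⁻¹) 1 = .id ℝ _ := by
    rw [← modelDeriv_id (1 : G)]
    apply modelDeriv_congr
    have : ∀ᶠ z : G in 𝓝 1, z * a ∈ φ.source :=
      (mdifferentiableAt_mul_right (E := E) a 1).continuousAt.eventually_mem
        (φ.open_source.mem_nhds (by simpa using has))
    filter_upwards [this] with z hz
    simp [hz]
  have hax : φ (1 * a) = x := by simp [ha, hx]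
  rw [e1, hfx] at h1
  rw [e2, hax] at h2
  exact ContinuousLinearMap.IsInvertible.of_inverse h2.symm h1.symm

theorem contDiffOn_logDeriv (hφ : IsLocalCoordinates E φ) :
    ContDiffOn ℝ ∞ (logDeriv E φ.symm) φ.target :=
  MagneticFlow.contDiffOn_logDeriv φ.open_target hφ.2

end IsLocalCoordinates

namespace CentralExtension

variable {F : LinearMap.BilinForm ℝ (GroupLieAlgebra 𝓘(ℝ, E) G)}
  {Ee : Type*} [NormedAddCommGroup Ee] [NormedSpace ℝ Ee]
  {Ge : Type*} [TopologicalSpace Ge] [ChartedSpace Ee Ge] [Group Ge]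
  (ext : CentralExtension F Ee Ge)
  {φ : OpenPartialHomeomorph G (Fin n → ℝ)} {W : Set (Fin n → ℝ)} {s : (Fin n → ℝ) → Ge}
  {x : Fin n → ℝ}

/-- The differential of the projection at the unit. -/
def projDeriv : Ee →L[ℝ] E := modelDeriv Ee E ext.proj 1

/-- The inclusion of the Lie algebra of `G`, as a map between the model spaces. -/
def liftModel : E →ₗ[ℝ] Ee := ext.lift

/-- The central element `Z`, as a vector of the model space. -/
def centre : Ee := ext.Z

omit [LieGroup 𝓘(ℝ, E) ∞ G] in
theorem projDeriv_lift (X : E) : ext.projDeriv (ext.liftModel X) = X := ext.proj_lift X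

omit [LieGroup 𝓘(ℝ, E) ∞ G] in
theorem projDeriv_eq_zero_iff (Y : Ee) : ext.projDeriv Y = 0 ↔ ∃ c : ℝ, Y = c • ext.centre :=
  ext.proj_ker Y

namespace IsLocalSection

variable {ext}

omit [LieGroup 𝓘(ℝ, E) ∞ G] in
theorem mdifferentiableAt (hs : ext.IsLocalSection φ W s) (hx : x ∈ W) :
    MDifferentiableAt 𝓘(ℝ, Fin n → ℝ) 𝓘(ℝ, Ee) s x :=
  (hs.2.2.1.contMDiffAt (hs.1.mem_nhds hx)).mdifferentiableAt (by simp)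

variable [LieGroup 𝓘(ℝ, Ee) ∞ Ge]

omit [LieGroup 𝓘(ℝ, E) ∞ G] in
theorem projDeriv_logDeriv (hs : ext.IsLocalSection φ W s) (hx : x ∈ W) (v : Fin n → ℝ) :
    ext.projDeriv (logDeriv Ee s x v) = logDeriv E φ.symm x v := by
  have h1 : (fun y => ext.proj (s y)) =ᶠ[𝓝 x] φ.symm := by
    filter_upwards [hs.1.mem_nhds hx] with y hy using hs.2.2.2 y hy
  rw [← logDeriv_congr h1, logDeriv_map ext.proj
    (ext.proj_smooth.mdifferentiableAt (by simp)) (hs.mdifferentiableAt hx)]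
  rfl

omit [LieGroup 𝓘(ℝ, E) ∞ G] in
theorem contMDiffOn_coords (hs : ext.IsLocalSection φ W s) :
    ContMDiffOn 𝓘(ℝ, Option (Fin n) → ℝ) 𝓘(ℝ, Ee) ∞ (ext.coords s)
      {y | (fun i => y (some i)) ∈ W} := by
  have h1 : ContMDiffOn 𝓘(ℝ, Option (Fin n) → ℝ) 𝓘(ℝ, Ee) ∞
      (fun y : Option (Fin n) → ℝ => s (fun i => y (some i))) {y | (fun i => y (some i)) ∈ W} :=
    hs.2.2.1.comp (ContDiff.contMDiff (by fun_prop)).contMDiffOn fun y hy => hy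
  have h2 : ContMDiff 𝓘(ℝ, Option (Fin n) → ℝ) 𝓘(ℝ, Ee) ∞
      (fun y : Option (Fin n) → ℝ => ext.fiber (y none)) :=
    ext.fiber_smooth.comp (ContDiff.contMDiff (by fun_prop))
  exact h1.mul h2.contMDiffOn

omit [LieGroup 𝓘(ℝ, E) ∞ G] in
-- Since the fibre is central, the quotient of two points splits as (s(x')s(x)⁻¹)·exp((t' - t)Z),
-- and the product rule at the unit gives the two summands.
theorem logDeriv_coords (hs : ext.IsLocalSection φ W s) {y : Option (Fin n) → ℝ}
    (hy : (fun i => y (some i)) ∈ W) (v : Option (Fin n) → ℝ) :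
    logDeriv Ee (ext.coords s) y v =
      logDeriv Ee s (fun i => y (some i)) (fun i => v (some i)) + v none • ext.centre := by
  let p : (Option (Fin n) → ℝ) →L[ℝ] (Fin n → ℝ) :=
    ContinuousLinearMap.pi fun i => ContinuousLinearMap.proj (some i)
  let q : (Option (Fin n) → ℝ) →L[ℝ] ℝ := ContinuousLinearMap.proj none
  have hfib : ∀ t, (ext.fiber t)⁻¹ = ext.fiber (-t) := fun t =>
    inv_eq_of_mul_eq_one_right (by rw [← ext.fiber_add]; simp [ext.fiber_zero])
  have hsplit : (fun y' => ext.coords s y' * (ext.coords s y)⁻¹) =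
      fun y' => (s (p y') * (s (p y))⁻¹) * ext.fiber (q y' - q y) := by
    ext y'
    change s (p y') * ext.fiber (q y') * (s (p y) * ext.fiber (q y))⁻¹ = _
    rw [sub_eq_add_neg, ext.fiber_add, ← hfib, mul_inv_rev, hfib, mul_assoc, mul_assoc,
      ← mul_assoc (ext.fiber (q y')) , ← ext.fiber_add, ext.fiber_central]
  have hsd := mdifferentiableAt_translate (hs.mdifferentiableAt hy) (s (p y))⁻¹
  have hfd : MDifferentiableAt 𝓘(ℝ, ℝ) 𝓘(ℝ, Ee) ext.fiber (q y - q y) :=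
    ext.fiber_smooth.mdifferentiableAt (by simp)
  have hqd : DifferentiableAt ℝ (fun y' => q y' - q y) y := by fun_prop
  have hp := p.differentiableAt (x := y)
  rw [logDeriv, hsplit, modelDeriv_mul
    (f := fun y' => s (p y') * (s (p y))⁻¹) (g := fun y' => ext.fiber (q y' - q y))
    (MDifferentiableAt.comp y (g := fun z => s z * (s (p y))⁻¹) hsd hp.mdifferentiableAt)
    (MDifferentiableAt.comp y hfd hqd.mdifferentiableAt),
    modelDeriv_comp y (g := fun z => s z * (s (p y))⁻¹) hsd hp.mdifferentiableAt,
    modelDeriv_comp y hfd hqd.mdifferentiableAt]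
  simp only [sub_self, ext.fiber_zero, mul_inv_cancel, mul_one, one_mul, modelDeriv_id,
    modelDeriv_eq_fderiv, fderiv_sub_const, ContinuousLinearMap.fderiv]
  have hZ : modelDeriv ℝ Ee ext.fiber 0 1 = ext.centre := ext.fiber_deriv
  have hq : modelDeriv ℝ Ee ext.fiber 0 (q v) = q v • ext.centre := by
    rw [← hZ, ← map_smul]; simp
  simp only [add_apply, ContinuousLinearMap.comp_apply, hq,
    ContinuousLinearMap.id_apply]
  rfl

omit [LieGroup 𝓘(ℝ, E) ∞ G] in
theorem exists_logDeriv_eq (hs : ext.IsLocalSection φ W s) (hx : x ∈ W) (v : Fin n → ℝ) :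
    ∃ c : ℝ, logDeriv Ee s x v = ext.liftModel (logDeriv E φ.symm x v) + c • ext.centre := by
  obtain ⟨c, hc⟩ := (ext.projDeriv_eq_zero_iff
    (logDeriv Ee s x v - ext.liftModel (logDeriv E φ.symm x v))).1
    (by rw [map_sub, hs.projDeriv_logDeriv hx, projDeriv_lift, sub_self])
  exact ⟨c, by rw [← hc]; abel⟩

/-- Modulo ℝZ the map is the invertible θ of the coordinates on G, and the coordinate g⁰ accounts
for the kernel ℝZ of the projection. -/
theorem isInvertible_logDeriv_coords (hφ : IsLocalCoordinates E φ)
    (hs : ext.IsLocalSection φ W s) {y : Option (Fin n) → ℝ}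
    (hy : (fun i => y (some i)) ∈ W) : (logDeriv Ee (ext.coords s) y).IsInvertible := by
  have hω := hφ.isInvertible_logDeriv (hs.2.1 hy)
  have hproj : ∀ v, ext.projDeriv (logDeriv Ee (ext.coords s) y v) =
      logDeriv E φ.symm (fun i => y (some i)) (fun i => v (some i)) := by
    intro v
    rw [hs.logDeriv_coords hy, map_add, hs.projDeriv_logDeriv hy, add_eq_left,
      projDeriv_eq_zero_iff]
    exact ⟨_, rfl⟩
  have hZ : ext.centre ≠ 0 := ext.Z_ne_zero
  have hbij : Function.Bijective (logDeriv Ee (ext.coords s) y : (Option (Fin n) → ℝ) →ₗ[ℝ] Ee) := by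
    constructor
    · rw [injective_iff_map_eq_zero]
      intro v hv
      replace hv : logDeriv Ee (ext.coords s) y v = 0 := hv
      have h1 : (fun i => v (some i)) = 0 := by
        have := hproj v
        rw [hv, map_zero] at this
        rw [← hω.inverse_apply_self (fun i => v (some i)), ← this, map_zero]
      rw [hs.logDeriv_coords hy, h1, map_zero, zero_add, smul_eq_zero, or_iff_left hZ] at hv
      ext (_ | i)
      · exact hv
      · exact congrFun h1 i
    · intro Y
      set u := (logDeriv E φ.symm (fun i => y (some i))).inverse (ext.projDeriv Y)
      obtain ⟨c, hc⟩ := (ext.projDeriv_eq_zero_iff (Y - logDeriv Ee s _ u)).1 (by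
        rw [map_sub, hs.projDeriv_logDeriv hy, hω.self_apply_inverse, sub_self])
      refine ⟨fun o => o.elim c u, ?_⟩
      change logDeriv Ee (ext.coords s) y _ = Y
      rw [hs.logDeriv_coords hy]
      simp only [Option.elim_none, Option.elim_some, ← hc]
      abel
  exact ⟨(LinearEquiv.ofBijective _ hbij).toContinuousLinearEquiv, by ext; rfl⟩

/-- The components of a section's logarithmic derivative along the centre. -/
theorem logDeriv_single (hφ : IsLocalCoordinates E φ) (hs : ext.IsLocalSection φ W s)
    (hx : x ∈ W) (i : Fin n) :
    logDeriv Ee s x (Pi.single i 1) = ext.liftModel (logDeriv E φ.symm x (Pi.single i 1)) +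
      ext.vectorPotential φ s x i • ext.centre := by
  obtain ⟨c, hc⟩ := hs.exists_logDeriv_eq hx (Pi.single i 1)
  have hy : (fun i => (fun o : Option (Fin n) => o.elim 0 x : Option (Fin n) → ℝ) (some i)) ∈ W := hx
  have hinv := hs.isInvertible_logDeriv_coords hφ (y := fun o => o.elim 0 x) hy
  have h1 : (logDeriv Ee (ext.coords s) (fun o => o.elim 0 x)).inverse
      (ext.liftModel (-(logDeriv E φ.symm x (Pi.single i 1)))) =
      fun o => o.elim c (-Pi.single i 1) := by
    rw [hinv.inverse_apply_eq, hs.logDeriv_coords (y := fun o => o.elim 0 x) hy]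
    simp only [Option.elim_none, Option.elim_some]
    change _ = logDeriv Ee s x (-Pi.single i 1) + _
    rw [map_neg, map_neg, hc]
    abel
  have h2 : ext.vectorPotential φ s x i = c := by
    change - -((logDeriv Ee (ext.coords s) (fun o => o.elim 0 x)).inverse
      (ext.liftModel (-(logDeriv E φ.symm x (Pi.single i 1)))) none) = c
    rw [h1]
    exact neg_neg c
  rw [hc, h2]

theorem logDeriv_eq (hφ : IsLocalCoordinates E φ) (hs : ext.IsLocalSection φ W s)
    (hx : x ∈ W) (v : Fin n → ℝ) :
    logDeriv Ee s x v = ext.liftModel (logDeriv E φ.symm x v) +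
      (∑ i, v i * ext.vectorPotential φ s x i) • ext.centre := by
  conv_lhs => rw [pi_eq_sum_univ' v]
  conv_rhs => enter [1]; rw [pi_eq_sum_univ' v]
  simp only [map_sum, map_smul, Finset.sum_smul, ← Finset.sum_add_distrib]
  refine Finset.sum_congr rfl fun i _ => ?_
  rw [hs.logDeriv_single hφ hx, smul_add, smul_smul]

omit [LieGroup 𝓘(ℝ, E) ∞ G] in
theorem contDiffOn_logDeriv (hs : ext.IsLocalSection φ W s) : ContDiffOn ℝ ∞ (logDeriv Ee s) W :=
  MagneticFlow.contDiffOn_logDeriv hs.1 hs.2.2.1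

/-- A section's vector potential, read off from logarithmic derivatives. -/
theorem exists_vectorPotential_eq [FiniteDimensional ℝ E] (hφ : IsLocalCoordinates E φ)
    (hs : ext.IsLocalSection φ W s) : ∃ (l : Ee →L[ℝ] ℝ) (L : E →L[ℝ] Ee),
      l ext.centre = 1 ∧ (∀ X, L X = ext.liftModel X) ∧
      ∀ x ∈ W, ∀ i, ext.vectorPotential φ s x i =
        l (logDeriv Ee s x (Pi.single i 1) - L (logDeriv E φ.symm x (Pi.single i 1))) := by
  have hZ : ext.centre ≠ 0 := ext.Z_ne_zero
  -- Any functional with l(Z) = 1 will do, even if it does not vanish on the lifted vectors: it is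
  -- applied only to multiples of Z. The resulting formula makes A visibly smooth.
  obtain ⟨l, hl⟩ := SeparatingDual.exists_eq_one (R := ℝ) hZ
  refine ⟨l, LinearMap.toContinuousLinearMap ext.liftModel, hl, fun X => rfl, fun x hx i => ?_⟩
  rw [hs.logDeriv_single hφ hx]
  simp [hl]

theorem contDiffOn_vectorPotential [FiniteDimensional ℝ E] (hφ : IsLocalCoordinates E φ)
    (hs : ext.IsLocalSection φ W s) : ContDiffOn ℝ ∞ (ext.vectorPotential φ s) W := by
  obtain ⟨l, L, -, -, h⟩ := hs.exists_vectorPotential_eq hφ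
  rw [contDiffOn_pi]
  intro i
  refine ContDiffOn.congr ?_ fun x hx => h x hx i
  have h1 := hs.contDiffOn_logDeriv
  have h2 := hφ.contDiffOn_logDeriv.mono hs.2.1
  fun_prop

/-- The vector potential is a primitive of the right-invariant 2-form. -/
theorem curl_vectorPotential [FiniteDimensional ℝ E] [FiniteDimensional ℝ Ee]
    (hφ : IsLocalCoordinates E φ)
    (hs : ext.IsLocalSection φ W s) (hx : x ∈ W) (i j : Fin n) :
    pd i (fun y => ext.vectorPotential φ s y j) x - pd j (fun y => ext.vectorPotential φ s y i) x =
      faraday F φ x i j := by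
  obtain ⟨l, L, hl, hL, h⟩ := hs.exists_vectorPotential_eq hφ
  have hW := hs.1.mem_nhds hx
  have hd1 : DifferentiableAt ℝ (logDeriv Ee s) x :=
    (hs.contDiffOn_logDeriv.contDiffAt hW).differentiableAt (by simp)
  have hd2 : DifferentiableAt ℝ (logDeriv E φ.symm) x :=
    ((hφ.contDiffOn_logDeriv.mono hs.2.1).contDiffAt hW).differentiableAt (by simp)
  have hpd : ∀ i j, pd i (fun y => ext.vectorPotential φ s y j) x =
      l (fderiv ℝ (logDeriv Ee s) x (Pi.single i 1) (Pi.single j 1) -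
        L (fderiv ℝ (logDeriv E φ.symm) x (Pi.single i 1) (Pi.single j 1))) := by
    intro i j
    have e1 : (fun y => ext.vectorPotential φ s y j) =ᶠ[𝓝 x] fun x =>
        l (logDeriv Ee s x (Pi.single j 1) - L (logDeriv E φ.symm x (Pi.single j 1))) := by
      filter_upwards [hW] with y hy using h y hy j
    have e2 : HasFDerivAt (fun x =>
        l (logDeriv Ee s x (Pi.single j 1) - L (logDeriv E φ.symm x (Pi.single j 1)))) _ x :=
      l.hasFDerivAt.comp x ((hd1.hasFDerivAt.clm_apply (hasFDerivAt_const _ x)).sub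
        (L.hasFDerivAt.comp x (hd2.hasFDerivAt.clm_apply (hasFDerivAt_const _ x))))
    rw [pd_eq, e1.fderiv_eq, e2.fderiv]
    simp
  have hU : IsOpen {y : Option (Fin n) → ℝ | (fun i => y (some i)) ∈ W} :=
    hs.1.preimage (by fun_prop)
  let p : (Option (Fin n) → ℝ) →L[ℝ] (Fin n → ℝ) :=
    ContinuousLinearMap.pi fun i => ContinuousLinearMap.proj (some i)
  let q : (Option (Fin n) → ℝ) →L[ℝ] ℝ := ContinuousLinearMap.proj none
  let y : Option (Fin n) → ℝ := fun o => o.elim 0 x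
  have hy : y ∈ {y : Option (Fin n) → ℝ | (fun i => y (some i)) ∈ W} := hx
  -- The lift of u at the point y whose logarithmic derivative has no component along Z. The
  -- coefficients are frozen at x, so no derivative of A arises from `c`.
  let c : (Fin n → ℝ) → Option (Fin n) → ℝ :=
    fun u o => o.elim (-∑ i, u i * ext.vectorPotential φ s x i) u
  have hpc : ∀ u, p (c u) = u := fun u => rfl
  have hc : ∀ u, logDeriv Ee (ext.coords s) y (c u) = ext.liftModel (logDeriv E φ.symm x u) := by
    intro u
    have := hs.logDeriv_coords (y := y) hy (c u)
    simp only [c, y, Option.elim_none, Option.elim_some] at this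
    rw [this, hs.logDeriv_eq hφ hx, neg_smul]
    abel
  -- The logarithmic derivatives of `coords` and of `s` differ by a constant form along dg⁰. Using
  -- `coords` instead of `s` supplies the invertibility that the Maurer–Cartan lemma requires.
  have hD : ∀ u w, fderiv ℝ (logDeriv Ee (ext.coords s)) y (c u) (c w) =
      fderiv ℝ (logDeriv Ee s) x u w := by
    intro u w
    have e1 : logDeriv Ee (ext.coords s) =ᶠ[𝓝 y] fun y =>
        (logDeriv Ee s (p y)).comp p + q.smulRight ext.centre := by
      filter_upwards [hU.mem_nhds hy] with y hy
      ext v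
      rw [hs.logDeriv_coords hy]
      rfl
    have e2 : HasFDerivAt (fun y => logDeriv Ee s (p y)) _ y :=
      HasFDerivAt.comp y (g := logDeriv Ee s) (f := p) hd1.hasFDerivAt p.hasFDerivAt
    have e3 := (e2.clm_comp (hasFDerivAt_const p y)).add_const (q.smulRight ext.centre)
    rw [e1.fderiv_eq, e3.fderiv]
    simp [hpc]
  have m1 := MagneticFlow.fderiv_logDeriv_sub φ.open_target hφ.2
    (fun x hx => hφ.isInvertible_logDeriv hx) (hs.2.1 hx) (Pi.single i 1) (Pi.single j 1)
  have m2 := MagneticFlow.fderiv_logDeriv_sub hU hs.contMDiffOn_coords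
    (fun x hx => hs.isInvertible_logDeriv_coords hφ hx) hy (c (Pi.single i 1)) (c (Pi.single j 1))
  rw [hD, hD, hc, hc] at m2
  have m3 : modelBracket Ee Ge (ext.liftModel (logDeriv E φ.symm x (Pi.single i 1)))
      (ext.liftModel (logDeriv E φ.symm x (Pi.single j 1))) =
      ext.liftModel (modelBracket E G (logDeriv E φ.symm x (Pi.single i 1))
        (logDeriv E φ.symm x (Pi.single j 1))) + faraday F φ x i j • ext.centre :=
    ext.lie_lift (logDeriv E φ.symm x (Pi.single i 1)) (logDeriv E φ.symm x (Pi.single j 1))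
  rw [hpd, hpd, ← map_sub, sub_sub_sub_comm, m2, ← map_sub, m1, m3, hL, add_sub_cancel_left,
    map_smul, hl, smul_eq_mul, mul_one]

/-- The lift of X has the coordinate components (-A(u), u), where u are the components of X on G.
Hence the covector (p₀, p), restricted to the lifted vectors, is p - p₀A. -/
theorem extHam_eq [FiniteDimensional ℝ E] (B : LinearMap.BilinForm ℝ (GroupLieAlgebra 𝓘(ℝ, E) G))
    (hB : B.Nondegenerate) (hφ : IsLocalCoordinates E φ) (hs : ext.IsLocalSection φ W s)
    {w : Option (Fin n) ⊕ Option (Fin n) → ℝ} (hw : (fun i => w (Sum.inl (some i))) ∈ W) :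
    ext.extHam B hB s w = geodesicHam B hB φ (Sum.elim (fun i => w (Sum.inl (some i)))
      (fun i => w (Sum.inr (some i)) - w (Sum.inr none) *
        ext.vectorPotential φ s (fun k => w (Sum.inl (some k))) i)) := by
  unfold extHam geodesicHam
  congr 2
  refine LinearMap.ext fun (X : E) => ?_
  set y : Option (Fin n) → ℝ := fun o => w (Sum.inl o)
  set x : Fin n → ℝ := fun i => w (Sum.inl (some i))
  have hω := hφ.isInvertible_logDeriv (hs.2.1 hw)
  have hinv := hs.isInvertible_logDeriv_coords hφ (y := y) hw
  set u := (logDeriv E φ.symm x).inverse X with hu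
  have h1 : (logDeriv Ee (ext.coords s) y).inverse (ext.liftModel X) =
      fun o => o.elim (-∑ i, u i * ext.vectorPotential φ s x i) u := by
    rw [hinv.inverse_apply_eq, hs.logDeriv_coords (y := y) hw]
    simp only [Option.elim_none, Option.elim_some]
    change _ = logDeriv Ee s x u + _
    rw [hs.logDeriv_eq hφ hw, hu, hω.self_apply_inverse, neg_smul]
    abel
  change (∑ o, w (Sum.inr o) • (LinearMap.proj o : (Option (Fin n) → ℝ) →ₗ[ℝ] ℝ))
      ((logDeriv Ee (ext.coords s) y).inverse (ext.liftModel X)) =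
    (∑ i, (w (Sum.inr (some i)) - w (Sum.inr none) * ext.vectorPotential φ s x i) •
      (LinearMap.proj i : (Fin n → ℝ) →ₗ[ℝ] ℝ)) u
  rw [h1]
  simp only [LinearMap.sum_apply, LinearMap.smul_apply, LinearMap.proj_apply, smul_eq_mul]
  simp only [Fintype.sum_option, Option.elim_none, Option.elim_some, sub_mul, Finset.sum_sub_distrib,
    mul_neg, Finset.mul_sum]
  rw [neg_add_eq_sub]
  congr 1
  exact Finset.sum_congr rfl fun i _ => by ring

end IsLocalSection

end CentralExtension

end Extension

/-! ### Existence and change of local sections -/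

theorem exists_contDiffOn_rightInverse {V : Type*} [NormedAddCommGroup V] [NormedSpace ℝ V]
    [CompleteSpace V] {f : V → V} {U : Set V} {c : V} (hU : IsOpen U) (hc : c ∈ U)
    (hf : ContDiffOn ℝ ∞ f U) (hfc : (fderiv ℝ f c).IsInvertible) :
    ∃ (W : Set V) (r : V → V), IsOpen W ∧ f c ∈ W ∧ MapsTo r W U ∧ ContDiffOn ℝ ∞ r W ∧
      ∀ x ∈ W, f (r x) = x := by
  have hfa : ∀ x ∈ U, ContDiffAt ℝ ∞ f x := fun x hx => hf.contDiffAt (hU.mem_nhds hx)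
  have hd : ∀ x ∈ U, HasFDerivAt f (fderiv ℝ f x) x := fun x hx =>
    ((hfa x hx).differentiableAt (by simp)).hasFDerivAt
  obtain ⟨e, he⟩ := hfc
  -- Invertibility of the derivative is needed near c and not only at c, so that the local inverse
  -- is smooth at every point of the open set.
  have hev : ∀ᶠ x in 𝓝 c, x ∈ U ∧ (fderiv ℝ f x).IsInvertible := by
    refine (hU.eventually_mem hc).and ?_
    have h1 : ContinuousAt (fderiv ℝ f) c :=
      ((hfa c hc).fderiv_right (m := 0) (by simp)).continuousAt
    have h2 := h1.eventually_mem (he ▸ e.nhds)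
    exact h2.mono fun x hx => hx
  obtain ⟨V', hV', hV'o, hcV'⟩ := eventually_nhds_iff.1 hev
  have hdc : HasFDerivAt f (e : V →L[ℝ] V) c := he ▸ hd c hc
  let R := (hfa c hc).toOpenPartialHomeomorph f hdc (by simp)
  have hcR : c ∈ R.source := (hfa c hc).mem_toOpenPartialHomeomorph_source hdc (by simp)
  have hRf : ∀ x, R x = f x := fun x => rfl
  refine ⟨R.target ∩ R.symm ⁻¹' V', R.symm, R.isOpen_inter_preimage_symm hV'o, ⟨?_, ?_⟩,
    fun x hx => (hV' _ hx.2).1, fun x hx => ?_, fun x hx => R.right_inv hx.1⟩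
  · exact R.map_source hcR
  · rw [mem_preimage, ← hRf, R.left_inv hcR]
    exact hcV'
  · obtain ⟨hxU, e', he'⟩ := hV' _ hx.2
    exact (R.contDiffAt_symm (f₀' := e') hx.1 (he' ▸ hd _ hxU) (hfa _ hxU)).contDiffWithinAt

section Extension

variable {E : Type*} [NormedAddCommGroup E] [NormedSpace ℝ E]
  {G : Type*} [TopologicalSpace G] [ChartedSpace E G] [Group G] [LieGroup 𝓘(ℝ, E) ∞ G]
  {n : ℕ}

namespace CentralExtension

variable {F : LinearMap.BilinForm ℝ (GroupLieAlgebra 𝓘(ℝ, E) G)}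
  {Ee : Type*} [NormedAddCommGroup Ee] [NormedSpace ℝ Ee]
  {Ge : Type*} [TopologicalSpace Ge] [ChartedSpace Ee Ge] [Group Ge]
  {ext : CentralExtension F Ee Ge}
  {φ : OpenPartialHomeomorph G (Fin n → ℝ)} {W : Set (Fin n → ℝ)} {s : (Fin n → ℝ) → Ge}
  {x : Fin n → ℝ}

omit [LieGroup 𝓘(ℝ, E) ∞ G] in
theorem IsLocalSection.mono (hs : ext.IsLocalSection φ W s) {W' : Set (Fin n → ℝ)}
    (hW' : IsOpen W') (h : W' ⊆ W) : ext.IsLocalSection φ W' s :=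
  ⟨hW', h.trans hs.2.1, hs.2.2.1.mono h, fun x hx => hs.2.2.2 x (h hx)⟩

variable [LieGroup 𝓘(ℝ, Ee) ∞ Ge]

omit [LieGroup 𝓘(ℝ, E) ∞ G] in
-- The gauge freedom: the fibre projects to the unit, so a section may be moved along it by any
-- smooth function.
theorem IsLocalSection.mul_fiber (hs : ext.IsLocalSection φ W s) {h : (Fin n → ℝ) → ℝ}
    (hh : ContDiffOn ℝ ∞ h W) : ext.IsLocalSection φ W (fun x => s x * ext.fiber (-h x)) := by
  refine ⟨hs.1, hs.2.1, hs.2.2.1.mul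
    (ext.fiber_smooth.comp_contMDiffOn hh.neg.contMDiffOn), fun x hx => ?_⟩
  rw [map_mul, ext.proj_fiber, mul_one, hs.2.2.2 x hx]

/-- The gauge transformation of the vector potential under a change of the section. -/
theorem IsLocalSection.vectorPotential_mul_fiber (hφ : IsLocalCoordinates E φ)
    (hs : ext.IsLocalSection φ W s) {h : (Fin n → ℝ) → ℝ} (hh : ContDiffOn ℝ ∞ h W)
    (hx : x ∈ W) (i : Fin n) :
    ext.vectorPotential φ (fun x => s x * ext.fiber (-h x)) x i =
      ext.vectorPotential φ s x i - pd i h x := by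
  have hs' := hs.mul_fiber hh
  have hU : IsOpen {y : Option (Fin n) → ℝ | (fun i => y (some i)) ∈ W} :=
    hs.1.preimage (by fun_prop)
  -- The new section is the graph g⁰ = -h(x) in the coordinates defined by the old one, so the chain
  -- rule applies.
  let f : (Fin n → ℝ) → Option (Fin n) → ℝ := fun x o => o.elim (-h x) x
  have hhd : HasFDerivAt h (fderiv ℝ h x) x :=
    ((hh.contDiffAt (hs.1.mem_nhds hx)).differentiableAt (by simp)).hasFDerivAt
  have hf : HasFDerivAt f (ContinuousLinearMap.pi fun o : Option (Fin n) =>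
      o.elim (-fderiv ℝ h x) fun i => ContinuousLinearMap.proj i) x := by
    rw [hasFDerivAt_pi]
    rintro (_ | i)
    · exact hhd.neg
    · exact hasFDerivAt_apply i x
  have hfx : (fun i => f x (some i)) ∈ W := hx
  have hcd : MDifferentiableAt 𝓘(ℝ, Option (Fin n) → ℝ) 𝓘(ℝ, Ee) (ext.coords s) (f x) :=
    (hs.contMDiffOn_coords.contMDiffAt (hU.mem_nhds hfx)).mdifferentiableAt (by simp)
  have h1 := logDeriv_comp (E := Ee) hcd hf.differentiableAt
  have h2 : logDeriv Ee (fun x => s x * ext.fiber (-h x)) x (Pi.single i 1) =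
      logDeriv Ee s x (Pi.single i 1) + (-pd i h x) • ext.centre := by
    change logDeriv Ee (fun x => ext.coords s (f x)) x (Pi.single i 1) = _
    rw [h1, hf.fderiv, ContinuousLinearMap.comp_apply, hs.logDeriv_coords hfx, pd_eq]
    rfl
  rw [hs.logDeriv_single hφ hx, hs'.logDeriv_single hφ hx, add_assoc, ← add_smul] at h2
  have hZ : ext.centre ≠ 0 := ext.Z_ne_zero
  have h3 := smul_left_injective ℝ hZ (add_left_cancel h2)
  rw [h3, sub_eq_add_neg]

omit [LieGroup 𝓘(ℝ, E) ∞ G] in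
-- Take the inverse of the chart at the unit along an affine map with linear part L, then translate
-- on the right by g; the translation does not change the logarithmic derivative.
theorem exists_logDeriv_eq_at [FiniteDimensional ℝ Ee] (L : (Fin n → ℝ) →L[ℝ] Ee) (c : Fin n → ℝ)
    (g : Ge) : ∃ (U : Set (Fin n → ℝ)) (T : (Fin n → ℝ) → Ge), IsOpen U ∧ c ∈ U ∧ T c = g ∧
      ContMDiffOn 𝓘(ℝ, Fin n → ℝ) 𝓘(ℝ, Ee) ∞ T U ∧ logDeriv Ee T c = L := by
  have : IsManifold 𝓘(ℝ, Ee) ∞ Ge := LieGroup.toContMDiffMul.toIsManifold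
  set χ := extChartAt 𝓘(ℝ, Ee) (1 : Ge) with hχ
  let a : (Fin n → ℝ) → Ee := fun v => χ 1 + L (v - c)
  have hac : a c = χ 1 := by simp [a]
  have ha : ContDiff ℝ ∞ a := by fun_prop
  have hU : IsOpen (a ⁻¹' χ.target) := (isOpen_extChartAt_target _).preimage ha.continuous
  have hcU : c ∈ a ⁻¹' χ.target := by
    rw [mem_preimage, hac]; exact mem_extChartAt_target _
  have hT : ContMDiffOn 𝓘(ℝ, Fin n → ℝ) 𝓘(ℝ, Ee) ∞ (fun v => χ.symm (a v)) (a ⁻¹' χ.target) :=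
    (contMDiffOn_extChartAt_symm (1 : Ge)).comp ha.contMDiff.contMDiffOn fun v hv => hv
  have hTc : χ.symm (a c) = 1 := by rw [hac]; exact extChartAt_to_inv _
  refine ⟨a ⁻¹' χ.target, fun v => χ.symm (a v) * g, hU, hcU, by simp [hTc], ?_, ?_⟩
  · exact hT.mul contMDiffOn_const
  · rw [logDeriv_mul_const, logDeriv_eq_fderiv
      ((hT.contMDiffAt (hU.mem_nhds hcU)).mdifferentiableAt (by simp)), hTc]
    have h1 : (fun y => extChartAt 𝓘(ℝ, Ee) (1 : Ge) (χ.symm (a y) * (1 : Ge)⁻¹)) =ᶠ[𝓝 c] a := by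
      filter_upwards [hU.mem_nhds hcU] with y hy
      rw [inv_one, mul_one]
      exact χ.right_inv hy
    have h2 : HasFDerivAt a L c := by
      have := (L.hasFDerivAt.comp c ((hasFDerivAt_id c).sub_const c)).const_add (χ 1)
      exact this
    rw [h1.fderiv_eq, h2.fderiv]

/-- The projection of the extension has smooth local sections. -/
theorem exists_isLocalSection [FiniteDimensional ℝ E] [FiniteDimensional ℝ Ee]
    (ext : CentralExtension F Ee Ge) (hφ : IsLocalCoordinates E φ)
    {c : Fin n → ℝ} (hc : c ∈ φ.target) : ∃ W s, c ∈ W ∧ ext.IsLocalSection φ W s := by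
  obtain ⟨g, hg⟩ := ext.proj_surjective (φ.symm c)
  -- With this prescribed derivative, T covers the coordinate parametrization to first order at c:
  -- the map f = φ ∘ proj ∘ T has derivative 1 there. Composing T with a local right inverse of f
  -- gives an exact section.
  obtain ⟨U, T, hU, hcU, hTc, hT, hTL⟩ := exists_logDeriv_eq_at (Ee := Ee)
    ((LinearMap.toContinuousLinearMap ext.liftModel).comp (logDeriv E φ.symm c)) c g
  have hpT : ContMDiffOn 𝓘(ℝ, Fin n → ℝ) 𝓘(ℝ, E) ∞ (fun v => ext.proj (T v)) U :=
    ext.proj_smooth.comp_contMDiffOn hT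
  set U' := U ∩ (fun v => ext.proj (T v)) ⁻¹' φ.source with hU'
  have hU'o : IsOpen U' := hpT.continuousOn.isOpen_inter_preimage hU φ.open_source
  have hpTc : ext.proj (T c) = φ.symm c := by rw [hTc, hg]
  have hcU' : c ∈ U' := ⟨hcU, by rw [mem_preimage, hpTc]; exact φ.map_target hc⟩
  let f : (Fin n → ℝ) → Fin n → ℝ := fun v => φ (ext.proj (T v))
  have hfc : f c = c := by simp only [f, hpTc, φ.right_inv hc]
  have hf : ContDiffOn ℝ ∞ f U' := by
    rw [← contMDiffOn_iff_contDiffOn]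
    exact hφ.1.comp (hpT.mono inter_subset_left) fun v hv => hv.2
  have hfd : DifferentiableAt ℝ f c :=
    (hf.contDiffAt (hU'o.mem_nhds hcU')).differentiableAt (by simp)
  have hTd := (hT.contMDiffAt (hU.mem_nhds hcU)).mdifferentiableAt (by simp)
  have h1 : logDeriv E (fun v => φ.symm (f v)) c = logDeriv E φ.symm c := by
    have : (fun v => φ.symm (f v)) =ᶠ[𝓝 c] fun v => ext.proj (T v) := by
      filter_upwards [hU'o.mem_nhds hcU'] with v hv
      exact φ.left_inv hv.2
    rw [logDeriv_congr this, logDeriv_map ext.proj (ext.proj_smooth.mdifferentiableAt (by simp)) hTd,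
      hTL]
    ext v
    exact ext.projDeriv_lift _
  rw [logDeriv_comp (by rw [hfc]; exact hφ.mdifferentiableAt_symm hc) hfd, hfc] at h1
  have hid : fderiv ℝ f c = .id ℝ _ := by
    have hω := hφ.isInvertible_logDeriv hc
    ext1 v
    have h2 := congrArg (fun A => A v) h1
    simp only [ContinuousLinearMap.comp_apply] at h2
    rw [← hω.inverse_apply_self (fderiv ℝ f c v), h2, hω.inverse_apply_self]
    rfl
  obtain ⟨W, r, hW, hcW, hrU, hr, hfr⟩ := exists_contDiffOn_rightInverse hU'o hcU' hf
    (by rw [hid]; exact ⟨ContinuousLinearEquiv.refl ℝ _, rfl⟩)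
  rw [hfc] at hcW
  refine ⟨W ∩ φ.target, fun x => T (r x), ⟨hcW, hc⟩, hW.inter φ.open_target, inter_subset_right,
    ?_, ?_⟩
  · exact hT.comp (hr.contMDiffOn.mono inter_subset_left) fun x hx => (hrU hx.1).1
  · intro x hx
    have := hfr x hx.1
    have h2 : ext.proj (T (r x)) ∈ φ.source := (hrU hx.1).2
    rw [← φ.left_inv h2]
    exact congrArg φ.symm this

end CentralExtension

/-! ### The metric -/

variable [FiniteDimensional ℝ E] (B : LinearMap.BilinForm ℝ (GroupLieAlgebra 𝓘(ℝ, E) G))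
  (hB : B.Nondegenerate) (φ : OpenPartialHomeomorph G (Fin n → ℝ))

variable (E) in
/-- The covector `dxⁱ`, translated to the unit. -/
def basicMoment (x : Fin n → ℝ) (i : Fin n) : E →L[ℝ] ℝ :=
  (ContinuousLinearMap.proj i).comp (logDeriv E φ.symm x).inverse

/-- The isomorphism of the dual of the Lie algebra with the Lie algebra given by the form. -/
def sharp : (E →ₗ[ℝ] ℝ) →ₗ[ℝ] E :=
  ((B.toDual hB).symm : Module.Dual ℝ (GroupLieAlgebra 𝓘(ℝ, E) G) →ₗ[ℝ] GroupLieAlgebra 𝓘(ℝ, E) G)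

/-- The components of the right-invariant metric on covectors. -/
def coMetric (x : Fin n → ℝ) : Matrix (Fin n) (Fin n) ℝ := fun i j =>
  basicMoment E φ x i (sharp B hB (basicMoment E φ x j))

omit [LieGroup 𝓘(ℝ, E) ∞ G] in
theorem apply_sharp (l l' : E →ₗ[ℝ] ℝ) : l (sharp B hB l') = B (sharp B hB l) (sharp B hB l') :=
  (LinearMap.BilinForm.apply_toDual_symm_apply (B := B) (hB := hB) l (sharp B hB l')).symm

omit [LieGroup 𝓘(ℝ, E) ∞ G] in
theorem sharp_eq_zero {l : E →ₗ[ℝ] ℝ} (h : sharp B hB l = 0) : l = 0 :=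
  (B.toDual hB).symm.map_eq_zero_iff.1 h

omit [LieGroup 𝓘(ℝ, E) ∞ G] in
theorem geodesicHam_eq (z : Fin n ⊕ Fin n → ℝ) :
    geodesicHam B hB φ z = (∑ i, ∑ j, coMetric B hB φ (fun k => z (Sum.inl k)) i j *
      z (Sum.inr i) * z (Sum.inr j)) / 2 := by
  set x : Fin n → ℝ := fun k => z (Sum.inl k)
  set l : E →ₗ[ℝ] ℝ := ∑ i, z (Sum.inr i) • (basicMoment E φ x i : E →ₗ[ℝ] ℝ) with hl
  have h : rightMoment φ.symm z = l := by
    refine LinearMap.ext fun (X : E) => ?_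
    change (∑ i, z (Sum.inr i) • (LinearMap.proj i : (Fin n → ℝ) →ₗ[ℝ] ℝ))
      ((logDeriv E φ.symm x).inverse X) = l X
    simp only [hl, LinearMap.sum_apply, LinearMap.smul_apply]
    rfl
  change rightMoment φ.symm z (sharp B hB (rightMoment φ.symm z)) / 2 = _
  rw [h]
  change l (sharp B hB l) / 2 = _
  congr 1
  simp only [hl, map_sum, map_smul, LinearMap.sum_apply, LinearMap.smul_apply, smul_eq_mul,
    coMetric, Finset.mul_sum]
  rw [Finset.sum_comm]
  exact Finset.sum_congr rfl fun i _ => Finset.sum_congr rfl fun j _ => by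
    rw [ContinuousLinearMap.coe_coe]; ring

variable {B}

omit [LieGroup 𝓘(ℝ, E) ∞ G] in
theorem coMetric_comm (hBs : B.IsSymm) (x : Fin n → ℝ) (i j : Fin n) :
    coMetric B hB φ x i j = coMetric B hB φ x j i := by
  have h1 := apply_sharp B hB (basicMoment E φ x i : E →ₗ[ℝ] ℝ) (basicMoment E φ x j)
  have h2 := apply_sharp B hB (basicMoment E φ x j : E →ₗ[ℝ] ℝ) (basicMoment E φ x i)
  exact h1.trans ((hBs.eq _ _).symm.trans h2.symm)

variable {φ}

/-- If p is in the kernel, all coordinate differentials vanish on the vector dual to the covector p;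
that vector is then zero, and so is p. -/
theorem det_coMetric_ne_zero (hφ : IsLocalCoordinates E φ) {x : Fin n → ℝ} (hx : x ∈ φ.target) :
    (coMetric B hB φ x).det ≠ 0 := by
  intro h0
  obtain ⟨p, hp, hMp⟩ := Matrix.exists_mulVec_eq_zero_iff.2 h0
  have hω := hφ.isInvertible_logDeriv hx
  apply hp
  set l : E →ₗ[ℝ] ℝ := ∑ j, p j • (basicMoment E φ x j : E →ₗ[ℝ] ℝ) with hl
  have h1 : (logDeriv E φ.symm x).inverse (sharp B hB l) = 0 := by
    ext i
    refine Eq.trans ?_ (congrFun hMp i)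
    change basicMoment E φ x i (sharp B hB l) = _
    simp only [hl, map_sum, map_smul, Matrix.mulVec, dotProduct, coMetric, smul_eq_mul]
    exact Finset.sum_congr rfl fun j _ => mul_comm _ _
  have h2 : sharp B hB l = 0 := by
    rw [← hω.self_apply_inverse (sharp B hB l), h1, map_zero]
  have h3 := sharp_eq_zero B hB h2
  ext i
  have h4 := congrArg (fun m : E →ₗ[ℝ] ℝ => m (logDeriv E φ.symm x (Pi.single i 1))) h3
  simpa [hl, basicMoment, hω.inverse_apply_self, Pi.single_apply] using h4

theorem contDiffOn_coMetric (hφ : IsLocalCoordinates E φ) (i j : Fin n) :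
    ContDiffOn ℝ ∞ (fun x => coMetric B hB φ x i j) φ.target := by
  have hinv : ContDiffOn ℝ ∞ (fun x => (logDeriv E φ.symm x).inverse) φ.target := by
    have : CompleteSpace E := FiniteDimensional.complete ℝ E
    intro x hx
    exact ((hφ.isInvertible_logDeriv hx).contDiffAt_map_inverse).comp_contDiffWithinAt x
      (hφ.contDiffOn_logDeriv x hx)
  have hb : ∀ i, ContDiffOn ℝ ∞ (fun x => basicMoment E φ x i) φ.target := fun i =>
    contDiffOn_const.clm_comp hinv
  let S : (E →L[ℝ] ℝ) →L[ℝ] E :=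
    LinearMap.toContinuousLinearMap (sharp B hB ∘ₗ ContinuousLinearMap.coeLM ℝ)
  exact (hb i).clm_apply (S.contDiff.comp_contDiffOn (hb j))

theorem contDiffOn_faraday (F : LinearMap.BilinForm ℝ (GroupLieAlgebra 𝓘(ℝ, E) G))
    (hφ : IsLocalCoordinates E φ) (i j : Fin n) :
    ContDiffOn ℝ ∞ (fun x => faraday F φ x i j) φ.target := by
  let F₁ : E →ₗ[ℝ] E →ₗ[ℝ] ℝ := F
  let F₂ : E →L[ℝ] E →L[ℝ] ℝ := LinearMap.toContinuousLinearMap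
    ((LinearMap.toContinuousLinearMap : (E →ₗ[ℝ] ℝ) ≃ₗ[ℝ] (E →L[ℝ] ℝ)).toLinearMap ∘ₗ F₁)
  have h := hφ.contDiffOn_logDeriv
  change ContDiffOn ℝ ∞ (fun x => F₂ (logDeriv E φ.symm x (Pi.single i 1))
    (logDeriv E φ.symm x (Pi.single j 1))) φ.target
  fun_prop

end Extension

/-! ### Momentum shifts and the magnetic deformation -/

section Shift

variable {ι : Type}

theorem isOpen_phaseDomain {W : Set (ι → ℝ)} (hW : IsOpen W) : IsOpen (phaseDomain W) :=
  hW.preimage (by fun_prop)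

variable [Fintype ι]

theorem fderiv_eq_sum_pd (f : (ι → ℝ) → ℝ) (x v : ι → ℝ) :
    fderiv ℝ f x v = ∑ i, v i * pd i f x := by
  classical
  conv_lhs => rw [pi_eq_sum_univ' v]
  simp only [map_sum, map_smul, smul_eq_mul]
  exact Finset.sum_congr rfl fun i _ => by rw [pd_eq]

theorem HasFDerivAt.pd_eq_apply [DecidableEq ι] {f : (ι → ℝ) → ℝ} {f' : (ι → ℝ) →L[ℝ] ℝ}
    {x : ι → ℝ} (h : HasFDerivAt f f' x) (i : ι) : pd i f x = f' (Pi.single i 1) := by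
  rw [pd_eq, h.fderiv]

theorem pd_congr {f g : (ι → ℝ) → ℝ} {x : ι → ℝ} (h : f =ᶠ[𝓝 x] g) (i : ι) :
    pd i f x = pd i g x := by
  unfold pd
  rw [h.fderiv_eq]

theorem pd_comp {κ : Type} [Fintype κ] [DecidableEq κ] {f : (ι → ℝ) → ℝ} {g : (κ → ℝ) → ι → ℝ}
    {g' : (κ → ℝ) →L[ℝ] (ι → ℝ)} {x : κ → ℝ} (hf : DifferentiableAt ℝ f (g x))
    (hg : HasFDerivAt g g' x) (k : κ) :
    pd k (fun y => f (g y)) x = ∑ i, g' (Pi.single k 1) i * pd i f (g x) := by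
  have h : HasFDerivAt (fun y => f (g y)) _ x := hf.hasFDerivAt.comp x hg
  rw [HasFDerivAt.pd_eq_apply h, ContinuousLinearMap.comp_apply, fderiv_eq_sum_pd]

/-- The projection of the phase space onto the space of positions. -/
def position (ι : Type) : (ι ⊕ ι → ℝ) →L[ℝ] (ι → ℝ) :=
  ContinuousLinearMap.pi fun j => ContinuousLinearMap.proj (R := ℝ) (φ := fun _ => ℝ) (Sum.inl j)

omit [Fintype ι] in
theorem position_apply (z : ι ⊕ ι → ℝ) : position ι z = fun k => z (Sum.inl k) := rfl

/-- The derivative of the shift of momenta. -/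
def shiftDeriv (e : ℝ) (A' : (ι → ℝ) →L[ℝ] (ι → ℝ)) : (ι ⊕ ι → ℝ) →L[ℝ] (ι ⊕ ι → ℝ) :=
  ContinuousLinearMap.pi fun k => ContinuousLinearMap.proj (R := ℝ) (φ := fun _ => ℝ) k +
    k.elim (fun _ => 0) fun i => e • ((ContinuousLinearMap.proj i).comp A').comp (position ι)

omit [Fintype ι] in
theorem shiftDeriv_inl (e : ℝ) (A' : (ι → ℝ) →L[ℝ] (ι → ℝ)) (v : ι ⊕ ι → ℝ) (i : ι) :
    shiftDeriv e A' v (Sum.inl i) = v (Sum.inl i) := by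
  simp [shiftDeriv]

omit [Fintype ι] in
theorem shiftDeriv_inr (e : ℝ) (A' : (ι → ℝ) →L[ℝ] (ι → ℝ)) (v : ι ⊕ ι → ℝ) (i : ι) :
    shiftDeriv e A' v (Sum.inr i) = v (Sum.inr i) + e * A' (position ι v) i := by
  simp [shiftDeriv]

theorem hasFDerivAt_momentumShift (e : ℝ) {A : (ι → ℝ) → ι → ℝ} {A' : (ι → ℝ) →L[ℝ] (ι → ℝ)}
    {z : ι ⊕ ι → ℝ} (hA : HasFDerivAt A A' (fun k => z (Sum.inl k))) :
    HasFDerivAt (momentumShift e A) (shiftDeriv e A') z := by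
  refine hasFDerivAt_pi.2 ?_
  rintro (i | i)
  · exact (hasFDerivAt_apply _ z).add (hasFDerivAt_const 0 z)  |>.congr_of_eventuallyEq
      (Eventually.of_forall fun z => (add_zero (z (Sum.inl i))).symm)
  · have h2 : HasFDerivAt (fun z : ι ⊕ ι → ℝ => A (position ι z) i) _ z :=
      HasFDerivAt.comp z (g := fun x => A x i) ((hasFDerivAt_pi'.1 hA) i)
        (position ι).hasFDerivAt
    exact (hasFDerivAt_apply (Sum.inr i) z).add (h2.const_mul e)

variable {e : ℝ} {A : (ι → ℝ) → ι → ℝ} {z : ι ⊕ ι → ℝ} {H : (ι ⊕ ι → ℝ) → ℝ}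

theorem pd_inl_comp_momentumShift (hA : DifferentiableAt ℝ A (fun k => z (Sum.inl k)))
    (hH : DifferentiableAt ℝ H (momentumShift e A z)) (i : ι) :
    pd (Sum.inl i) (fun z => H (momentumShift e A z)) z =
      pd (Sum.inl i) H (momentumShift e A z) +
        ∑ j, e * pd i (fun x => A x j) (fun k => z (Sum.inl k)) *
          pd (Sum.inr j) H (momentumShift e A z) := by
  classical
  have hAj : ∀ j, HasFDerivAt (fun x => A x j) _ (fun k => z (Sum.inl k)) :=
    hasFDerivAt_pi'.1 hA.hasFDerivAt
  have hP : position ι (Pi.single (Sum.inl i) 1) = Pi.single i 1 := by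
    ext j
    simp [position_apply, Pi.single_apply]
  rw [pd_comp hH (hasFDerivAt_momentumShift e hA.hasFDerivAt), Fintype.sum_sum_type]
  congr 1
  · simp [shiftDeriv_inl, Pi.single_apply]
  · refine Finset.sum_congr rfl fun j _ => ?_
    rw [HasFDerivAt.pd_eq_apply (hAj j)]
    simp [shiftDeriv_inr, hP]

theorem pd_inr_comp_momentumShift (hA : DifferentiableAt ℝ A (fun k => z (Sum.inl k)))
    (hH : DifferentiableAt ℝ H (momentumShift e A z)) (i : ι) :
    pd (Sum.inr i) (fun z => H (momentumShift e A z)) z =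
      pd (Sum.inr i) H (momentumShift e A z) := by
  classical
  have hP : position ι (Pi.single (Sum.inr i) 1) = 0 := by
    ext j
    simp [position_apply]
  rw [pd_comp hH (hasFDerivAt_momentumShift e hA.hasFDerivAt), Fintype.sum_sum_type]
  simp [shiftDeriv_inl, shiftDeriv_inr, hP, Pi.single_apply]

/-- The shift of momenta by a vector potential takes the canonical Hamiltonian system to the
system deformed by the magnetic field. -/
theorem fderiv_momentumShift_hamField {F : (ι → ℝ) → ι → ι → ℝ}
    (hA : DifferentiableAt ℝ A (fun k => z (Sum.inl k)))
    (hH : DifferentiableAt ℝ H (momentumShift e A z))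
    (hF : ∀ i j, pd i (fun x => A x j) (fun k => z (Sum.inl k)) -
      pd j (fun x => A x i) (fun k => z (Sum.inl k)) = F (fun k => z (Sum.inl k)) i j) :
    fderiv ℝ (momentumShift e A) z (hamField (fun z => H (momentumShift e A z)) z) =
      magField e F H (momentumShift e A z) := by
  rw [(hasFDerivAt_momentumShift e hA.hasFDerivAt).fderiv]
  have hAj : ∀ j, HasFDerivAt (fun x => A x j) _ (fun k => z (Sum.inl k)) :=
    hasFDerivAt_pi'.1 hA.hasFDerivAt
  ext (i | i)
  · rw [shiftDeriv_inl]
    exact pd_inr_comp_momentumShift hA hH i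
  · have h1 : shiftDeriv e (fderiv ℝ A (fun k => z (Sum.inl k)))
        (hamField (fun z => H (momentumShift e A z)) z) (Sum.inr i) =
        -pd (Sum.inl i) (fun z => H (momentumShift e A z)) z +
          e * fderiv ℝ (fun x => A x i) (fun k => z (Sum.inl k))
            (fun j => pd (Sum.inr j) (fun z => H (momentumShift e A z)) z) := by
      rw [(hAj i).fderiv, shiftDeriv_inr]
      rfl
    have h2 : ∀ j, F (fun k => momentumShift e A z (Sum.inl k)) i j = _ := fun j => (hF i j).symm
    rw [h1, fderiv_eq_sum_pd, pd_inl_comp_momentumShift hA hH]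
    simp only [pd_inr_comp_momentumShift hA hH, magField, h2, sub_mul, Finset.sum_sub_distrib,
      mul_sub, Finset.mul_sum]
    -- Here b comes from differentiating the shift inside H and contains ∂ᵢAⱼ; c is the rate of
    -- change of eAᵢ along the motion and contains ∂ⱼAᵢ. Together they form the curl.
    have h3 : ∀ a b c d f : ℝ, b = f → c = d → -(a + b) + c = -a - (f - d) := by
      rintro a b c d f rfl rfl; ring
    exact h3 _ _ _ _ _ (Finset.sum_congr rfl fun j _ => by ring)
      (Finset.sum_congr rfl fun j _ => by ring)

end Shift

/-! ### The subsystem at the level p₀ = -e -/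

section Reduction

variable {E : Type*} [NormedAddCommGroup E] [NormedSpace ℝ E] [FiniteDimensional ℝ E]
  {G : Type*} [TopologicalSpace G] [ChartedSpace E G] [Group G] [LieGroup 𝓘(ℝ, E) ∞ G]
  {n : ℕ} {B : LinearMap.BilinForm ℝ (GroupLieAlgebra 𝓘(ℝ, E) G)} (hB : B.Nondegenerate)
  {φ : OpenPartialHomeomorph G (Fin n → ℝ)}

theorem contDiffOn_geodesicHam (hφ : IsLocalCoordinates E φ) :
    ContDiffOn ℝ ∞ (geodesicHam B hB φ) (phaseDomain φ.target) := by
  have h : ∀ i j, ContDiffOn ℝ ∞ (fun z : Fin n ⊕ Fin n → ℝ =>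
      coMetric B hB φ (fun k => z (Sum.inl k)) i j) (phaseDomain φ.target) := fun i j =>
    (contDiffOn_coMetric hB hφ i j).comp (f := fun z : Fin n ⊕ Fin n → ℝ => fun k => z (Sum.inl k))
      (ContDiff.contDiffOn (by fun_prop)) fun z hz => hz
  have e : geodesicHam B hB φ = _ := funext (geodesicHam_eq B hB φ)
  rw [e]
  fun_prop

theorem differentiableAt_geodesicHam (hφ : IsLocalCoordinates E φ) {z : Fin n ⊕ Fin n → ℝ}
    (hz : z ∈ phaseDomain φ.target) : DifferentiableAt ℝ (geodesicHam B hB φ) z :=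
  ((contDiffOn_geodesicHam hB hφ).contDiffAt
    ((isOpen_phaseDomain φ.open_target).mem_nhds hz)).differentiableAt (by simp)

namespace CentralExtension.IsLocalSection

variable {F : LinearMap.BilinForm ℝ (GroupLieAlgebra 𝓘(ℝ, E) G)}
  {Ee : Type*} [NormedAddCommGroup Ee] [NormedSpace ℝ Ee]
  {Ge : Type*} [TopologicalSpace Ge] [ChartedSpace Ee Ge] [Group Ge] [LieGroup 𝓘(ℝ, Ee) ∞ Ge]
  {ext : CentralExtension F Ee Ge} {W : Set (Fin n → ℝ)} {s : (Fin n → ℝ) → Ge}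

theorem differentiableAt_vectorPotential (hφ : IsLocalCoordinates E φ)
    (hs : ext.IsLocalSection φ W s) {x : Fin n → ℝ} (hx : x ∈ W) :
    DifferentiableAt ℝ (ext.vectorPotential φ s) x :=
  ((hs.contDiffOn_vectorPotential hφ).contDiffAt (hs.1.mem_nhds hx)).differentiableAt (by simp)

theorem differentiableAt_extHam (hφ : IsLocalCoordinates E φ) (hs : ext.IsLocalSection φ W s)
    {w : Option (Fin n) ⊕ Option (Fin n) → ℝ}
    (hw : w ∈ phaseDomain {y : Option (Fin n) → ℝ | (fun i => y (some i)) ∈ W}) :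
    DifferentiableAt ℝ (ext.extHam B hB s) w := by
  have hU : IsOpen (phaseDomain {y : Option (Fin n) → ℝ | (fun i => y (some i)) ∈ W}) :=
    isOpen_phaseDomain (hs.1.preimage (by fun_prop))
  have h1 : ext.extHam B hB s =ᶠ[𝓝 w] fun w =>
      geodesicHam B hB φ (Sum.elim (fun i => w (Sum.inl (some i)))
      (fun i => w (Sum.inr (some i)) - w (Sum.inr none) *
        ext.vectorPotential φ s (fun k => w (Sum.inl (some k))) i)) := by
    filter_upwards [hU.mem_nhds hw] with w hw using hs.extHam_eq B hB hφ hw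
  refine DifferentiableAt.congr_of_eventuallyEq ?_ h1
  let T : (Option (Fin n) ⊕ Option (Fin n) → ℝ) → Fin n ⊕ Fin n → ℝ := fun w =>
    Sum.elim (fun i => w (Sum.inl (some i))) (fun i => w (Sum.inr (some i)) - w (Sum.inr none) *
      ext.vectorPotential φ s (fun k => w (Sum.inl (some k))) i)
  have hT : T w ∈ phaseDomain φ.target := hs.2.1 hw
  refine DifferentiableAt.comp w (f := T) (differentiableAt_geodesicHam hB hφ hT) ?_
  rw [differentiableAt_pi]
  have hA : DifferentiableAt ℝ (fun w : Option (Fin n) ⊕ Option (Fin n) → ℝ =>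
      ext.vectorPotential φ s (fun k => w (Sum.inl (some k)))) w :=
    DifferentiableAt.comp w (f := fun w : Option (Fin n) ⊕ Option (Fin n) → ℝ =>
      fun k => w (Sum.inl (some k))) (hs.differentiableAt_vectorPotential hφ hw) (by fun_prop)
  rintro (i | i)
  · simp only [T, Sum.elim_inl]; fun_prop
  · simp only [T, Sum.elim_inr]; fun_prop

/-- By `extHam_eq` the Hamiltonian is constant along the g⁰-axis. -/
theorem pd_center_extHam (hφ : IsLocalCoordinates E φ) (hs : ext.IsLocalSection φ W s)
    {w : Option (Fin n) ⊕ Option (Fin n) → ℝ}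
    (hw : w ∈ phaseDomain {y : Option (Fin n) → ℝ | (fun i => y (some i)) ∈ W}) :
    pd (Sum.inl none) (ext.extHam B hB s) w = 0 := by
  rw [pd_eq, ← (hs.differentiableAt_extHam hB hφ hw).lineDeriv_eq_fderiv, lineDeriv]
  have : (fun t : ℝ => ext.extHam B hB s (w + t • Pi.single (Sum.inl none) 1)) =
      fun _ => ext.extHam B hB s w := by
    ext t
    rw [hs.extHam_eq B hB hφ hw, hs.extHam_eq B hB hφ (by simpa using! hw)]
    simp
  rw [this, deriv_const]

omit [LieGroup 𝓘(ℝ, Ee) ∞ Ge] [LieGroup 𝓘(ℝ, E) ∞ G] [FiniteDimensional ℝ E] in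
theorem hasFDerivAt_levelPoint (e g0 : ℝ) (z : Fin n ⊕ Fin n → ℝ) :
    HasFDerivAt (levelPoint e g0 : (Fin n ⊕ Fin n → ℝ) → _) (ContinuousLinearMap.pi fun o =>
      o.elim (fun o => o.elim 0 fun i => ContinuousLinearMap.proj (R := ℝ) (φ := fun _ => ℝ) (Sum.inl i))
        (fun o => o.elim 0 fun i => ContinuousLinearMap.proj (R := ℝ) (φ := fun _ => ℝ) (Sum.inr i))) z := by
  rw [hasFDerivAt_pi]
  rintro ((_ | i) | (_ | i))
  · exact hasFDerivAt_const _ _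
  · exact hasFDerivAt_apply _ z
  · exact hasFDerivAt_const _ _
  · exact hasFDerivAt_apply _ z

theorem extHam_levelPoint (hφ : IsLocalCoordinates E φ) (hs : ext.IsLocalSection φ W s) (e g0 : ℝ)
    {z : Fin n ⊕ Fin n → ℝ} (hz : z ∈ phaseDomain W) :
    ext.extHam B hB s (levelPoint e g0 z) =
      geodesicHam B hB φ (momentumShift e (ext.vectorPotential φ s) z) := by
  rw [hs.extHam_eq B hB hφ (w := levelPoint e g0 z) hz]
  congr 1
  ext (i | i)
  · rfl
  · simp [momentumShift, levelPoint]

/-- `levelPoint` is an affine embedding whose image directions are those of the retained coordinates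
and momenta, so these partial derivatives may be taken after restriction to the level. The result
does not involve g⁰. -/
theorem pd_extHam_levelPoint (hφ : IsLocalCoordinates E φ) (hs : ext.IsLocalSection φ W s)
    (e g0 : ℝ) {z : Fin n ⊕ Fin n → ℝ} (hz : z ∈ phaseDomain W) (k : Fin n ⊕ Fin n) :
    pd (Sum.map some some k) (ext.extHam B hB s) (levelPoint e g0 z) =
      pd k (fun z => geodesicHam B hB φ (momentumShift e (ext.vectorPotential φ s) z)) z := by
  have h1 : (fun z => ext.extHam B hB s (levelPoint e g0 z)) =ᶠ[𝓝 z]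
      fun z => geodesicHam B hB φ (momentumShift e (ext.vectorPotential φ s) z) := by
    filter_upwards [(isOpen_phaseDomain hs.1).mem_nhds hz] with z hz
      using hs.extHam_levelPoint hB hφ e g0 hz
  rw [← pd_congr h1, pd_comp (hs.differentiableAt_extHam hB hφ hz) (hasFDerivAt_levelPoint e g0 z)]
  rcases k with k | k <;>
  simp [Fintype.sum_sum_type, Fintype.sum_option, Pi.single_apply]

theorem reducedField_eq (hφ : IsLocalCoordinates E φ) (hs : ext.IsLocalSection φ W s)
    (e : ℝ) {z : Fin n ⊕ Fin n → ℝ} (hz : z ∈ phaseDomain W) :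
    ext.reducedField B hB e s z = hamField
      (fun z => geodesicHam B hB φ (momentumShift e (ext.vectorPotential φ s) z)) z := by
  ext (i | i)
  · exact hs.pd_extHam_levelPoint hB hφ e 0 hz (Sum.inr i)
  · exact congrArg Neg.neg (hs.pd_extHam_levelPoint hB hφ e 0 hz (Sum.inl i))

theorem fderiv_momentumShift_reducedField [FiniteDimensional ℝ Ee] (hφ : IsLocalCoordinates E φ)
    (hs : ext.IsLocalSection φ W s) (e : ℝ) {z : Fin n ⊕ Fin n → ℝ} (hz : z ∈ phaseDomain W) :
    fderiv ℝ (momentumShift e (ext.vectorPotential φ s)) z (ext.reducedField B hB e s z) =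
      magneticGeodesicField B hB F e φ (momentumShift e (ext.vectorPotential φ s) z) := by
  rw [hs.reducedField_eq hB hφ e hz]
  exact fderiv_momentumShift_hamField (hs.differentiableAt_vectorPotential hφ hz)
    (differentiableAt_geodesicHam hB hφ (hs.2.1 hz)) fun i j => hs.curl_vectorPotential hφ hz i j

end CentralExtension.IsLocalSection

end Reduction

/-! ### Algebra of functions obtained by quadratures -/

namespace Quad

variable {κ : Type} {N : Set (κ → ℝ)} {Z : (κ → ℝ) → κ → ℝ} {ι : Type} [Fintype ι]
  {U : Set (ι → ℝ)} {f g : (ι → ℝ) → ℝ}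

theorem isOpen (h : Quad N Z U f) : IsOpen U := by
  induction h <;> assumption

theorem neg (hf : Quad N Z U f) : Quad N Z U (fun x => -f x) :=
  ((Quad.const hf.isOpen (-1)).mul hf).congr fun x _ => by simp

theorem sub (hf : Quad N Z U f) (hg : Quad N Z U g) : Quad N Z U (fun x => f x - g x) :=
  (hf.add hg.neg).congr fun x _ => by simp [sub_eq_add_neg]

theorem sum {τ : Type} (hU : IsOpen U) {F : τ → (ι → ℝ) → ℝ} (s : Finset τ)
    (hF : ∀ j ∈ s, Quad N Z U (F j)) : Quad N Z U (fun x => ∑ j ∈ s, F j x) := by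
  classical
  induction s using Finset.induction_on with
  | empty => simpa using Quad.const hU 0
  | insert a s ha ih =>
    refine ((hF a (s.mem_insert_self a)).add
      (ih fun j hj => hF j (Finset.mem_insert_of_mem hj))).congr fun x _ => ?_
    simp [Finset.sum_insert ha]

theorem prod {τ : Type} (hU : IsOpen U) {F : τ → (ι → ℝ) → ℝ} (s : Finset τ)
    (hF : ∀ j ∈ s, Quad N Z U (F j)) : Quad N Z U (fun x => ∏ j ∈ s, F j x) := by
  classical
  induction s using Finset.induction_on with
  | empty => simpa using Quad.const hU 1
  | insert a s ha ih =>
    refine ((hF a (s.mem_insert_self a)).mul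
      (ih fun j hj => hF j (Finset.mem_insert_of_mem hj))).congr fun x _ => ?_
    simp [Finset.prod_insert ha]

variable {m : Type} [Fintype m] [DecidableEq m] {A : (ι → ℝ) → Matrix m m ℝ}

theorem det (hU : IsOpen U) (hA : ∀ i j, Quad N Z U (fun x => A x i j)) :
    Quad N Z U (fun x => (A x).det) := by
  refine (sum hU Finset.univ (F := fun (σ : Equiv.Perm m) x =>
    ((Equiv.Perm.sign σ : ℤ) : ℝ) * ∏ i, A x (σ i) i) fun σ _ =>
    (Quad.const hU _).mul (prod hU _ fun i _ => hA _ _)).congr fun x _ => ?_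
  exact (Matrix.det_apply' (A x)).symm

/-- Cramer's rule: an entry of the adjugate is a determinant with one row replaced by a basis
vector. -/
theorem matrix_inv (hU : IsOpen U) (hA : ∀ i j, Quad N Z U (fun x => A x i j))
    (hdet : ∀ x ∈ U, (A x).det ≠ 0) (i j : m) : Quad N Z U (fun x => (A x)⁻¹ i j) := by
  have h1 : Quad N Z U (fun x => ((A x).updateRow j (Pi.single i 1)).det) := by
    refine det hU fun k l => ?_
    by_cases hk : k = j
    · refine (Quad.const hU ((Pi.single i (1 : ℝ) : m → ℝ) l)).congr fun x _ => ?_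
      simp [hk]
    · refine (hA k l).congr fun x _ => ?_
      simp [Matrix.updateRow_ne hk]
  refine (((det hU hA).inv hdet).mul h1).congr fun x _ => ?_
  simp [Matrix.inv_def, Matrix.adjugate_apply]

/-- Known functions stay known if the components of the given vector field are expressed
through those of another one. -/
theorem trans {κ' : Type} {N' : Set (κ' → ℝ)} {Z' : (κ' → ℝ) → κ' → ℝ} (h : Quad N Z U f)
    (hZ : ∀ [Fintype κ] k, Quad N' Z' N (fun x => Z x k)) : Quad N' Z' U f := by
  induction h with
  -- The constructor carries its own `Fintype κ`, hence the instance argument in `hZ`.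
  | component hM k => exact hZ k
  | const hU c => exact .const hU c
  | coord hU i => exact .coord hU i
  | restrict _ hV hVU ih => exact ih.restrict hV hVU
  | congr _ hfg ih => exact ih.congr hfg
  | add _ _ ih₁ ih₂ => exact ih₁.add ih₂
  | mul _ _ ih₁ ih₂ => exact ih₁.mul ih₂
  | inv _ h0 ih => exact ih.inv h0
  | comp hU _ _ hUV ih₁ ih₂ => exact .comp hU ih₁ ih₂ hUV
  | deriv _ i ih => exact ih.deriv i
  | inversion _ hV hVU hh hgh i ih => exact .inversion ih hV hVU hh hgh i
  | quadrature _ hV i c hVU ih => exact ih.quadrature hV i c hVU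

end Quad

/-! ### Transfer of solutions along a conjugacy -/

section Transfer

variable {κ : Type} [Fintype κ]

/-- The general solution of `ẏ = X y` in `O` is obtained near some point of `O` by quadratures from
the components of `Z` on `N`. -/
def HasQuadSolution {κ' : Type} (N : Set (κ' → ℝ)) (Z : (κ' → ℝ) → κ' → ℝ) (O : Set (κ → ℝ))
    (X : (κ → ℝ) → κ → ℝ) : Prop :=
  ∃ (ε : ℝ) (U : Set (κ → ℝ)) (Ψ : ℝ → (κ → ℝ) → κ → ℝ),
    0 < ε ∧ U ⊆ O ∧ IsOpen U ∧ U.Nonempty ∧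
    (∀ y ∈ U, Ψ 0 y = y ∧ ∀ t ∈ Ioo (-ε) ε,
      Ψ t y ∈ O ∧ HasDerivAt (fun s => Ψ s y) (X (Ψ t y)) t) ∧
    ∀ k : κ, Quad N Z
      {w : Option κ → ℝ | w none ∈ Ioo (-ε) ε ∧ (fun j => w (some j)) ∈ U}
      (fun w => Ψ (w none) (fun j => w (some j)) k)

theorem HasQuadSolution.mono {κ' : Type} {N : Set (κ' → ℝ)} {Z : (κ' → ℝ) → κ' → ℝ}
    {O O' : Set (κ → ℝ)} {X : (κ → ℝ) → κ → ℝ} (h : HasQuadSolution N Z O X) (hO : O ⊆ O') :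
    HasQuadSolution N Z O' X := by
  obtain ⟨ε, U, Ψ, hε, hUO, hU, hUn, hΨ, hq⟩ := h
  exact ⟨ε, U, Ψ, hε, hUO.trans hO, hU, hUn, fun y hy => ⟨(hΨ y hy).1, fun t ht =>
    ⟨hO ((hΨ y hy).2 t ht).1, ((hΨ y hy).2 t ht).2⟩⟩, hq⟩

/-- A diffeomorphism with known components that takes the field `Y` to the field `X` transfers
solvability by quadratures from `X` to `Y`. -/
theorem HasQuadSolution.of_conj {κ' : Type} {N : Set (κ' → ℝ)} {Z : (κ' → ℝ) → κ' → ℝ}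
    {O O' : Set (κ → ℝ)} {X Y S S' : (κ → ℝ) → κ → ℝ} (hO : IsOpen O) (hO' : IsOpen O')
    (hS : ContDiffOn ℝ ∞ S O) (hS' : ContDiffOn ℝ ∞ S' O') (hSO' : MapsTo S' O' O)
    (hl : ∀ z ∈ O, S' (S z) = z) (hr : ∀ z ∈ O', S (S' z) = z)
    (hconj : ∀ z ∈ O, fderiv ℝ S z (Y z) = X (S z))
    (hSq : ∀ k, Quad N Z O (fun z => S z k)) (hYq : ∀ k, Quad N Z O (fun z => Y z k))
    (h : HasQuadSolution O' X O' X) : HasQuadSolution N Z O Y := by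
  have hSd : ∀ z ∈ O, HasFDerivAt S (fderiv ℝ S z) z := fun z hz =>
    ((hS.contDiffAt (hO.mem_nhds hz)).differentiableAt (by simp)).hasFDerivAt
  have hSd' : ∀ z ∈ O', HasFDerivAt S' (fderiv ℝ S' z) z := fun z hz =>
    ((hS'.contDiffAt (hO'.mem_nhds hz)).differentiableAt (by simp)).hasFDerivAt
  -- Inversion is an admitted operation, so S' comes for free once S is known.
  have hS'q : ∀ k, Quad N Z O' (fun z => S' z k) := fun k =>
    Quad.inversion hSq hO' hSO' hS' (fun y hy j => congrFun (hr y hy) j) k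
  -- The field X is (DS·Y) ∘ S', hence known. Thus the solution of X, given in terms of X, can be
  -- re-expressed through Z.
  have hXq : ∀ k, Quad N Z O' (fun z => X z k) := by
    intro k
    have h1 : Quad N Z O (fun z => ∑ j, Y z j * pd j (fun z => S z k) z) :=
      Quad.sum hO _ fun j _ => (hYq j).mul ((hSq k).deriv j)
    refine (Quad.comp hO' h1 hS'q hSO').congr fun z hz => ?_
    have h2 := congrFun (hconj _ (hSO' hz)) k
    rw [hr z hz] at h2
    rw [← h2]
    refine (fderiv_eq_sum_pd (fun z => S z k) (S' z) (Y (S' z))).symm.trans ?_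
    rw [((hasFDerivAt_pi'.1 (hSd _ (hSO' hz))) k).fderiv]
    rfl
  obtain ⟨ε, U, Ψ, hε, hUO, hU, ⟨u, hu⟩, hΨ, hq⟩ := h
  have hU'o : IsOpen (O ∩ S ⁻¹' U) := hS.continuousOn.isOpen_inter_preimage hO hU
  refine ⟨ε, O ∩ S ⁻¹' U, fun t y => S' (Ψ t (S y)), hε, inter_subset_left, hU'o,
    ⟨S' u, hSO' (hUO hu), by rwa [mem_preimage, hr _ (hUO hu)]⟩, fun y hy => ⟨?_, fun t ht => ?_⟩,
    fun k => ?_⟩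
  · change S' (Ψ 0 (S y)) = y
    rw [(hΨ _ hy.2).1, hl y hy.1]
  · obtain ⟨h1, h2⟩ := (hΨ _ hy.2).2 t ht
    have hz := hSO' h1
    refine ⟨hz, ?_⟩
    have h3 := (hSd' _ h1).comp_hasDerivAt t h2
    -- Differentiating S' ∘ S = id inverts the conjugacy relation: DS' takes X back to Y.
    have h4 : fderiv ℝ S' (Ψ t (S y)) (X (Ψ t (S y))) = Y (S' (Ψ t (S y))) := by
      have h5 : HasFDerivAt (fun z => S' (S z)) _ (S' (Ψ t (S y))) :=
        HasFDerivAt.comp _ (by rw [hr _ h1]; exact hSd' _ h1) (hSd _ hz)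
      have h6 : (fun z => S' (S z)) =ᶠ[𝓝 (S' (Ψ t (S y)))] id := by
        filter_upwards [hO.mem_nhds hz] with z hz using hl z hz
      have h7 := h5.unique ((hasFDerivAt_id _).congr_of_eventuallyEq h6)
      have h8 := hconj _ hz
      rw [hr _ h1] at h8
      rw [← h8]
      exact congrArg (fun L => L (Y (S' (Ψ t (S y))))) h7
    rw [h4] at h3
    exact h3
  · set D : Set (Option κ → ℝ) :=
      {w | w none ∈ Ioo (-ε) ε ∧ (fun j => w (some j)) ∈ O ∩ S ⁻¹' U} with hD
    have hDo : IsOpen D := (isOpen_Ioo.preimage (by fun_prop)).inter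
      (hU'o.preimage (f := fun (w : Option κ → ℝ) j => w (some j)) (by fun_prop))
    have hSD : ∀ j, Quad N Z D (fun w => S (fun j => w (some j)) j) := fun j =>
      Quad.comp hDo (hSq j) (fun i => .coord hDo (some i)) fun w hw => hw.2.1
    let b : Option κ → (Option κ → ℝ) → ℝ := fun o =>
      o.elim (fun w => w none) fun j w => S (fun j => w (some j)) j
    have hb : ∀ o, Quad N Z D (b o) := by
      rintro (_ | j)
      · exact .coord hDo none
      · exact hSD j
    have hΨq : ∀ k, Quad N Z D (fun w => Ψ (w none) (S (fun j => w (some j))) k) := fun k =>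
      Quad.comp hDo ((hq k).trans fun k => by convert! hXq k) hb fun w hw => ⟨hw.1, hw.2.2⟩
    exact Quad.comp hDo (hS'q k) hΨq fun w hw => ((hΨ _ hw.2.2).2 _ hw.1).1

end Transfer

/-! ### Smooth dependence of integrals on parameters -/

section ParametricIntegral

variable {V F : Type} [NormedAddCommGroup V] [NormedSpace ℝ V] [FiniteDimensional ℝ V]
  [NormedAddCommGroup F] [NormedSpace ℝ F]

theorem hasFDerivAt_integral_of_contDiffOn {D : Set (V × ℝ)} (hD : IsOpen D) {f : V × ℝ → F}
    (hf : ContDiffOn ℝ 1 f D) {x : V} (hx : ∀ t ∈ Icc (0 : ℝ) 1, (x, t) ∈ D) :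
    HasFDerivAt (fun x => ∫ t in (0 : ℝ)..1, f (x, t))
      (∫ t in (0 : ℝ)..1, (fderiv ℝ f (x, t)).comp (ContinuousLinearMap.inl ℝ V ℝ)) x := by
  have : ProperSpace V := FiniteDimensional.proper ℝ V
  -- The tube lemma gives a closed ball times [0, 1] inside D; by compactness the derivative is
  -- bounded there by a constant, which serves as the dominating function.
  obtain ⟨u, v, hu, hv, hxu, htv, huv⟩ := generalized_tube_lemma (s := {x}) isCompact_singleton
    (t := Icc (0 : ℝ) 1) isCompact_Icc hD (by rintro ⟨y, t⟩ ⟨rfl, ht⟩; exact hx t ht)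
  obtain ⟨ρ, hρ, hball⟩ := Metric.nhds_basis_closedBall.mem_iff.1
    (hu.mem_nhds (hxu (mem_singleton x)))
  have hK : Metric.closedBall x ρ ×ˢ Icc (0 : ℝ) 1 ⊆ D :=
    (prod_mono hball htv).trans huv
  have hf' : ContinuousOn (fderiv ℝ f) D := hf.continuousOn_fderiv_of_isOpen hD le_rfl
  let f' : V → ℝ → V →L[ℝ] F := fun x t =>
    (fderiv ℝ f (x, t)).comp (ContinuousLinearMap.inl ℝ V ℝ)
  have hf'c : ContinuousOn (fun p : V × ℝ => f' p.1 p.2) D := hf'.clm_comp continuousOn_const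
  obtain ⟨C, hC⟩ := ((isCompact_closedBall x ρ).prod isCompact_Icc).exists_bound_of_continuousOn
    (hf'c.mono hK)
  have hsub : Set.uIoc (0 : ℝ) 1 ⊆ Icc 0 1 := by
    rw [uIoc_of_le zero_le_one]; exact Ioc_subset_Icc_self
  have hslice : ∀ y ∈ Metric.closedBall x ρ, MapsTo (fun t : ℝ => (y, t)) (Icc 0 1) D :=
    fun y hy t ht => hK ⟨hy, ht⟩
  have hcont : ∀ y ∈ Metric.closedBall x ρ, ContinuousOn (fun t => f (y, t)) (Icc 0 1) :=
    fun y hy => hf.continuousOn.comp (by fun_prop) (hslice y hy)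
  have hxb : x ∈ Metric.closedBall x ρ := Metric.mem_closedBall_self hρ.le
  refine intervalIntegral.hasFDerivAt_integral_of_dominated_of_fderiv_le
    (F := fun y t => f (y, t)) (F' := f') (bound := fun _ => C)
    (Metric.ball_mem_nhds x hρ) ?_ ?_ ?_ ?_ ?_ ?_
  · filter_upwards [Metric.ball_mem_nhds x hρ] with y hy
    exact ((hcont y (Metric.ball_subset_closedBall hy)).mono hsub).aestronglyMeasurable
      measurableSet_uIoc
  · exact ((hcont x hxb).mono (by rw [uIcc_of_le zero_le_one])).intervalIntegrable
  · have : ContinuousOn (f' x) (Icc 0 1) := hf'c.comp (by fun_prop) (hslice x hxb)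
    exact (this.mono hsub).aestronglyMeasurable measurableSet_uIoc
  · exact Eventually.of_forall fun t ht y hy =>
      hC (y, t) ⟨Metric.ball_subset_closedBall hy, hsub ht⟩
  · exact intervalIntegrable_const
  · refine Eventually.of_forall fun t ht y hy => ?_
    have hd : HasFDerivAt f (fderiv ℝ f (y, t)) (y, t) :=
      ((hf.contDiffAt (hD.mem_nhds (hK ⟨Metric.ball_subset_closedBall hy, hsub ht⟩))).differentiableAt
        (by simp)).hasFDerivAt
    exact hd.comp y (hasFDerivAt_prodMk_left y t)

/-- The induction quantifies over the target F because its step passes to the derivative, whose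
values lie in V →L[ℝ] F. -/
theorem contDiffOn_integral_nat {D : Set (V × ℝ)} (hD : IsOpen D) {W : Set V} (hW : IsOpen W)
    (hWD : ∀ x ∈ W, ∀ t ∈ Icc (0 : ℝ) 1, (x, t) ∈ D) (k : ℕ) :
    ∀ {F : Type} [NormedAddCommGroup F] [NormedSpace ℝ F] [CompleteSpace F] {f : V × ℝ → F},
      ContDiffOn ℝ ∞ f D → ContDiffOn ℝ k (fun x => ∫ t in (0 : ℝ)..1, f (x, t)) W := by
  induction k with
  | zero =>
    intro F _ _ _ f hf
    refine contDiffOn_zero.2 fun x hx => ?_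
    exact (hasFDerivAt_integral_of_contDiffOn hD (hf.of_le (by simp))
      (hWD x hx)).continuousAt.continuousWithinAt
  | succ k ih =>
    intro F _ _ _ f hf
    have h := fun x (hx : x ∈ W) => hasFDerivAt_integral_of_contDiffOn hD (hf.of_le (by simp))
      (hWD x hx)
    push_cast
    rw [contDiffOn_succ_iff_fderiv_of_isOpen hW]
    refine ⟨fun x hx => (h x hx).differentiableAt.differentiableWithinAt, by simp, ?_⟩
    refine (ih (f := fun p => (fderiv ℝ f p).comp (ContinuousLinearMap.inl ℝ V ℝ))
      ((hf.fderiv_of_isOpen hD (by simp)).clm_comp contDiffOn_const)).congr fun x hx => ?_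
    exact (h x hx).fderiv

theorem contDiffOn_integral [CompleteSpace F] {D : Set (V × ℝ)} (hD : IsOpen D) {W : Set V} (hW : IsOpen W)
    (hWD : ∀ x ∈ W, ∀ t ∈ Icc (0 : ℝ) 1, (x, t) ∈ D) {f : V × ℝ → F} (hf : ContDiffOn ℝ ∞ f D) :
    ContDiffOn ℝ ∞ (fun x => ∫ t in (0 : ℝ)..1, f (x, t)) W :=
  contDiffOn_infty.2 fun k => contDiffOn_integral_nat hD hW hWD k hf

end ParametricIntegral

/-! ### The radial gauge and Poincaré's primitive -/

section Radial

variable {ι : Type} [Fintype ι]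

/-- The point that divides the segment from `c` to `x` in the ratio `t : (1 - t)`. -/
def segmentPoint (c x : ι → ℝ) (t : ℝ) : ι → ℝ := c + t • (x - c)

theorem segmentPoint_mem_ball {c x : ι → ℝ} {r t : ℝ} (hx : x ∈ Metric.ball c r)
    (ht : t ∈ Icc (0 : ℝ) 1) : segmentPoint c x t ∈ Metric.ball c r := by
  rw [Metric.mem_ball, dist_eq_norm] at *
  simp only [segmentPoint, add_sub_cancel_left, norm_smul, Real.norm_eq_abs, abs_of_nonneg ht.1]
  exact (mul_le_of_le_one_left (norm_nonneg _) ht.2).trans_lt hx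

/-- The gauge function that makes the potential `A` radial. -/
def radialGauge (c : ι → ℝ) (A : (ι → ℝ) → ι → ℝ) (x : ι → ℝ) : ℝ :=
  ∫ t in (0 : ℝ)..1, ∑ i, A (segmentPoint c x t) i * (x i - c i)

variable {c : ι → ℝ} {r : ℝ} {A : (ι → ℝ) → ι → ℝ}

theorem isOpen_segmentPoint_preimage (c : ι → ℝ) (r : ℝ) :
    IsOpen {p : (ι → ℝ) × ℝ | segmentPoint c p.1 p.2 ∈ Metric.ball c r} :=
  Metric.isOpen_ball.preimage (f := fun p : (ι → ℝ) × ℝ => segmentPoint c p.1 p.2)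
    (by unfold segmentPoint; fun_prop)

theorem contDiffOn_radialIntegrand (hA : ContDiffOn ℝ ∞ A (Metric.ball c r)) :
    ContDiffOn ℝ ∞ (fun p : (ι → ℝ) × ℝ => ∑ i, A (segmentPoint c p.1 p.2) i * (p.1 i - c i))
      {p : (ι → ℝ) × ℝ | segmentPoint c p.1 p.2 ∈ Metric.ball c r} := by
  have h1 : ContDiffOn ℝ ∞ (fun p : (ι → ℝ) × ℝ => A (segmentPoint c p.1 p.2))
      {p : (ι → ℝ) × ℝ | segmentPoint c p.1 p.2 ∈ Metric.ball c r} :=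
    hA.comp (f := fun p : (ι → ℝ) × ℝ => segmentPoint c p.1 p.2)
      (ContDiff.contDiffOn (by unfold segmentPoint; fun_prop)) fun p hp => hp
  have h2 : ∀ i, ContDiffOn ℝ ∞ (fun p : (ι → ℝ) × ℝ => A (segmentPoint c p.1 p.2) i)
      {p : (ι → ℝ) × ℝ | segmentPoint c p.1 p.2 ∈ Metric.ball c r} := contDiffOn_pi.1 h1
  exact ContDiffOn.sum fun i _ => (h2 i).mul (ContDiff.contDiffOn (by fun_prop))

theorem contDiffOn_radialGauge (hA : ContDiffOn ℝ ∞ A (Metric.ball c r)) :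
    ContDiffOn ℝ ∞ (radialGauge c A) (Metric.ball c r) :=
  contDiffOn_integral (isOpen_segmentPoint_preimage c r) Metric.isOpen_ball
    (fun _ hx _ ht => segmentPoint_mem_ball hx ht) (contDiffOn_radialIntegrand hA)

/-- In the radial gauge the vector potential is an integral of the magnetic field. -/
theorem sub_pd_radialGauge (hA : ContDiffOn ℝ ∞ A (Metric.ball c r)) {x : ι → ℝ}
    (hx : x ∈ Metric.ball c r) (j : ι) :
    A x j - pd j (radialGauge c A) x = ∫ t in (0 : ℝ)..1, t * ∑ i,
      (pd i (fun y => A y j) (segmentPoint c x t) - pd j (fun y => A y i) (segmentPoint c x t)) *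
        (x i - c i) := by
  classical
  set D := {p : (ι → ℝ) × ℝ | segmentPoint c p.1 p.2 ∈ Metric.ball c r} with hD
  have hDo : IsOpen D := isOpen_segmentPoint_preimage c r
  have hxD : ∀ t ∈ Icc (0 : ℝ) 1, (x, t) ∈ D := fun t ht => segmentPoint_mem_ball hx ht
  have hG := contDiffOn_radialIntegrand hA
  set g := fun p : (ι → ℝ) × ℝ => ∑ i, A (segmentPoint c p.1 p.2) i * (p.1 i - c i) with hg
  have hAd : ∀ y ∈ Metric.ball c r, HasFDerivAt A (fderiv ℝ A y) y := fun y hy =>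
    ((hA.contDiffAt (Metric.isOpen_ball.mem_nhds hy)).differentiableAt (by simp)).hasFDerivAt
  have hAi : ∀ y ∈ Metric.ball c r, ∀ i, HasFDerivAt (fun y => A y i)
      (fderiv ℝ (fun y => A y i) y) y := fun y hy i =>
    ((hasFDerivAt_pi'.1 (hAd y hy)) i).differentiableAt.hasFDerivAt
  -- the derivative of the integrand with respect to the parameter
  have h1 : ∀ t ∈ Icc (0 : ℝ) 1, (fderiv ℝ g (x, t)).comp (ContinuousLinearMap.inl ℝ (ι → ℝ) ℝ)
      (Pi.single j 1) = A (segmentPoint c x t) j +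
        t * ∑ i, pd j (fun y => A y i) (segmentPoint c x t) * (x i - c i) := by
    intro t ht
    have hgd : HasFDerivAt g (fderiv ℝ g (x, t)) (x, t) :=
      ((hG.contDiffAt (hDo.mem_nhds (hxD t ht))).differentiableAt (by simp)).hasFDerivAt
    have e1 : HasFDerivAt (fun y => g (y, t)) _ x :=
      HasFDerivAt.comp x (g := g) (f := fun y => (y, t)) hgd (hasFDerivAt_prodMk_left x t)
    have e2 : HasFDerivAt (fun y => segmentPoint c y t) (t • ContinuousLinearMap.id ℝ (ι → ℝ)) x :=
      (((hasFDerivAt_id x).sub_const c).const_smul t).const_add c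
    have e3 : ∀ i, HasFDerivAt (fun y => A (segmentPoint c y t) i) _ x := fun i =>
      HasFDerivAt.comp x (g := fun y => A y i) (hAi _ (segmentPoint_mem_ball hx ht) i) e2
    have e4 : HasFDerivAt (fun y => g (y, t)) _ x := HasFDerivAt.fun_sum (u := Finset.univ)
      fun i _ => (e3 i).mul ((hasFDerivAt_apply i x).sub_const (c i))
    have e5 := congrArg (fun L => L (Pi.single j 1)) (e1.unique e4)
    refine e5.trans ?_
    simp [pd_eq, Finset.sum_add_distrib, Finset.mul_sum, Pi.single_apply]
    exact Finset.sum_congr rfl fun i _ => by ring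
  -- The integral of this derivative over [0, 1] is Aⱼ(x). The integrand of ∂ⱼh differs from it only
  -- in having ∂ⱼAᵢ in place of ∂ᵢAⱼ, so the terms without derivatives cancel and the curl remains.
  have h2 : ∀ t ∈ Icc (0 : ℝ) 1, HasDerivAt (fun t => t * A (segmentPoint c x t) j)
      (A (segmentPoint c x t) j +
        t * ∑ i, pd i (fun y => A y j) (segmentPoint c x t) * (x i - c i)) t := by
    intro t ht
    have e2 : HasDerivAt (fun t => segmentPoint c x t) (x - c) t :=
      (((hasDerivAt_id t).smul_const (x - c)).const_add c).congr_deriv (one_smul ℝ _)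
    have e3 : HasDerivAt (fun t => A (segmentPoint c x t) j) _ t :=
      (hAi _ (segmentPoint_mem_ball hx ht) j).comp_hasDerivAt t e2
    refine ((hasDerivAt_id t).mul e3).congr_deriv ?_
    rw [fderiv_eq_sum_pd]
    simp only [id, one_mul, Pi.sub_apply]
    congr 2
    exact Finset.sum_congr rfl fun i _ => mul_comm _ _
  have hseg : ContinuousOn (fun t => segmentPoint c x t) (uIcc (0 : ℝ) 1) := by
    unfold segmentPoint; fun_prop
  have hmaps : MapsTo (fun t => segmentPoint c x t) (uIcc (0 : ℝ) 1) (Metric.ball c r) := by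
    rw [uIcc_of_le zero_le_one]
    exact fun t ht => segmentPoint_mem_ball hx ht
  have hAc : ∀ i, ContinuousOn (fun t => A (segmentPoint c x t) i) (uIcc (0 : ℝ) 1) := fun i =>
    ((contDiffOn_pi.1 hA i).continuousOn).comp hseg hmaps
  have hpc : ∀ i k, ContinuousOn (fun t => pd k (fun y => A y i) (segmentPoint c x t))
      (uIcc (0 : ℝ) 1) := fun i k => by
    have : ContinuousOn (fun z => pd k (fun y => A y i) z) (Metric.ball c r) := by
      simp only [pd_eq]
      exact ((contDiffOn_pi.1 hA i).continuousOn_fderiv_of_isOpen Metric.isOpen_ball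
        (by simp)).clm_apply continuousOn_const
    exact this.comp hseg hmaps
  have hi : ∀ F : ι → ℝ → ℝ, (∀ i, ContinuousOn (F i) (uIcc (0 : ℝ) 1)) →
      IntervalIntegrable (fun t => A (segmentPoint c x t) j + t * ∑ i, F i t * (x i - c i))
        MeasureTheory.volume 0 1 := fun F hF => by
    have := hAc j
    exact (this.add (continuousOn_id.mul (continuousOn_finsetSum _ fun i _ =>
      (hF i).mul continuousOn_const))).intervalIntegrable
  have h3 : A x j = ∫ t in (0 : ℝ)..1, (A (segmentPoint c x t) j +
        t * ∑ i, pd i (fun y => A y j) (segmentPoint c x t) * (x i - c i)) := by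
    rw [intervalIntegral.integral_eq_sub_of_hasDerivAt
      (fun t ht => h2 t (by rwa [uIcc_of_le zero_le_one] at ht)) (hi _ fun i => hpc j i)]
    simp [segmentPoint]
  have h4 : pd j (radialGauge c A) x = ∫ t in (0 : ℝ)..1, (A (segmentPoint c x t) j +
        t * ∑ i, pd j (fun y => A y i) (segmentPoint c x t) * (x i - c i)) := by
    have e1 := hasFDerivAt_integral_of_contDiffOn hDo (hG.of_le (by simp)) hxD
    have e2 : ContinuousOn (fun t : ℝ =>
        (fderiv ℝ g (x, t)).comp (ContinuousLinearMap.inl ℝ (ι → ℝ) ℝ)) (uIcc 0 1) := by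
      refine ContinuousOn.clm_comp ?_ continuousOn_const
      refine (hG.continuousOn_fderiv_of_isOpen hDo (by simp)).comp (by fun_prop) ?_
      rw [uIcc_of_le zero_le_one]
      exact hxD
    rw [HasFDerivAt.pd_eq_apply (f := radialGauge c A) e1,
      ContinuousLinearMap.intervalIntegral_apply e2.intervalIntegrable]
    refine intervalIntegral.integral_congr fun t ht => h1 t ?_
    rwa [uIcc_of_le zero_le_one] at ht
  rw [h3, h4, ← intervalIntegral.integral_sub (hi _ fun i => hpc j i) (hi _ fun i => hpc i j)]
  refine intervalIntegral.integral_congr fun t _ => ?_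
  simp only [add_sub_add_left_eq_sub, ← mul_sub, ← Finset.sum_sub_distrib, ← sub_mul]

/-- Radial primitives of known functions are known. -/
theorem Quad.radial_integral {κ : Type} {N : Set (κ → ℝ)} {Z : (κ → ℝ) → κ → ℝ}
    {f : ι → (ι → ℝ) → ℝ} (hf : ∀ i, Quad N Z (Metric.ball c r) (f i)) :
    Quad N Z (Metric.ball c r) (fun x => ∫ t in (0 : ℝ)..1, t * ∑ i,
      f i (segmentPoint c x t) * (x i - c i)) := by
  classical
  -- A quadrature integrates in one of the variables, so the ray parameter is added as the variable
  -- `none`. The domain is star-shaped in it, as the ball is about its centre; the value 1 is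
  -- substituted afterwards.
  let p : (Option ι → ℝ) → ι → ℝ := fun y => segmentPoint c (fun i => y (some i)) (y none)
  set U : Set (Option ι → ℝ) := p ⁻¹' Metric.ball c r with hU
  have hp : Continuous p := by unfold p segmentPoint; fun_prop
  have hUo : IsOpen U := Metric.isOpen_ball.preimage hp
  have hpq : ∀ i, Quad N Z U (fun y => p y i) := fun i =>
    (Quad.add (.const hUo (c i)) ((Quad.coord hUo none).mul
      ((Quad.coord hUo (some i)).sub (.const hUo (c i))))).congr fun y _ => by
        simp [p, segmentPoint]
  have hg : Quad N Z U (fun y => y none * ∑ i, f i (p y) * (y (some i) - c i)) :=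
    (Quad.coord hUo none).mul (Quad.sum hUo _ fun i _ =>
      (Quad.comp hUo (hf i) hpq fun y hy => hy).mul
        ((Quad.coord hUo (some i)).sub (.const hUo (c i))))
  have hq := hg.quadrature hUo none 0 (by
    intro y hy s hs
    simp only [hU, p, mem_preimage, Metric.mem_ball, dist_eq_norm, segmentPoint,
      add_sub_cancel_left, norm_smul, Function.update_self, ne_eq, reduceCtorEq, not_false_eq_true,
      Function.update_of_ne, Real.norm_eq_abs] at hy ⊢
    refine lt_of_le_of_lt (mul_le_mul_of_nonneg_right ?_ (norm_nonneg _)) hy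
    have := abs_sub_left_of_mem_uIcc hs
    simpa using this)
  have hb : IsOpen (Metric.ball c r) := Metric.isOpen_ball
  let b : Option ι → (ι → ℝ) → ℝ := fun o => o.elim (fun _ => 1) fun i x => x i
  have hbq : ∀ o, Quad N Z (Metric.ball c r) (b o) := by
    rintro (_ | i)
    · exact .const hb 1
    · exact .coord hb i
  refine (Quad.comp hb hq hbq fun x hx => ?_).congr fun x hx => ?_
  · change segmentPoint c x 1 ∈ Metric.ball c r
    exact segmentPoint_mem_ball hx (by simp)
  · simp [p, b]

end Radial

/-! ### Recovering metric, potential and field from the equations of motion -/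

section Quadratic

variable {ι : Type} [Fintype ι]

theorem hasFDerivAt_comp_position {b : (ι → ℝ) → ℝ} {z : ι ⊕ ι → ℝ}
    (hb : DifferentiableAt ℝ b (position ι z)) :
    HasFDerivAt (fun z => b (position ι z)) ((fderiv ℝ b (position ι z)).comp (position ι)) z :=
  HasFDerivAt.comp z (g := b) hb.hasFDerivAt (position ι).hasFDerivAt

omit [Fintype ι] in
theorem position_single_inr [DecidableEq ι] (k : ι) :
    position ι (Pi.single (Sum.inr k) 1) = 0 := by
  ext j
  simp [position_apply]

/-- The partial derivatives of a function that is affine in the momenta. -/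
theorem pd_inr_of_affine {O : Set (ι ⊕ ι → ℝ)} (hO : IsOpen O) {Y : (ι ⊕ ι → ℝ) → ℝ}
    {m : ι → (ι → ℝ) → ℝ} {b : (ι → ℝ) → ℝ}
    (hY : ∀ z ∈ O, Y z = ∑ j, m j (position ι z) * z (Sum.inr j) + b (position ι z))
    {z : ι ⊕ ι → ℝ} (hz : z ∈ O) (hm : ∀ j, DifferentiableAt ℝ (m j) (position ι z))
    (hb : DifferentiableAt ℝ b (position ι z)) (k : ι) :
    pd (Sum.inr k) Y z = m k (position ι z) := by
  classical
  have h1 : Y =ᶠ[𝓝 z] fun z => ∑ j, m j (position ι z) * z (Sum.inr j) + b (position ι z) := by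
    filter_upwards [hO.mem_nhds hz] with z hz using hY z hz
  have h2 := (HasFDerivAt.fun_sum (u := Finset.univ) fun j _ =>
    (hasFDerivAt_comp_position (hm j)).mul (hasFDerivAt_apply (Sum.inr j) z)).add
      (hasFDerivAt_comp_position hb)
  rw [pd_congr h1]
  refine (HasFDerivAt.pd_eq_apply h2 (Sum.inr k)).trans ?_
  simp [position_single_inr, Pi.single_apply]

variable {M : (ι → ℝ) → Matrix ι ι ℝ} {z : ι ⊕ ι → ℝ}

/-- The kinetic energy of a metric with given components on covectors. -/
def kinetic (M : (ι → ℝ) → Matrix ι ι ℝ) (z : ι ⊕ ι → ℝ) : ℝ :=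
  (∑ i, ∑ j, M (position ι z) i j * z (Sum.inr i) * z (Sum.inr j)) / 2

theorem pd_kinetic [DecidableEq ι] (hM : ∀ i j, DifferentiableAt ℝ (fun x => M x i j) (position ι z))
    (k : ι ⊕ ι) : pd k (kinetic M) z = (∑ i, ∑ j,
      (pd k (fun z => M (position ι z) i j) z * z (Sum.inr i) * z (Sum.inr j) +
        M (position ι z) i j * ((Pi.single k 1 : ι ⊕ ι → ℝ) (Sum.inr i) * z (Sum.inr j) +
          z (Sum.inr i) * (Pi.single k 1 : ι ⊕ ι → ℝ) (Sum.inr j)))) / 2 := by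
  have h := (HasFDerivAt.fun_sum (u := Finset.univ) fun i _ =>
    HasFDerivAt.fun_sum (u := Finset.univ) fun j _ =>
      ((hasFDerivAt_comp_position (hM i j)).mul (hasFDerivAt_apply (Sum.inr i) z)).mul
        (hasFDerivAt_apply (Sum.inr j) z)).mul_const ((2 : ℝ)⁻¹)
  have e : kinetic M = fun z => (∑ i, ∑ j, M (position ι z) i j * z (Sum.inr i) *
      z (Sum.inr j)) * (2 : ℝ)⁻¹ := by
    ext z; rw [kinetic, div_eq_mul_inv]
  rw [e]
  refine (HasFDerivAt.pd_eq_apply h k).trans ?_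
  rw [div_eq_mul_inv, mul_comm]
  simp only [HasFDerivAt.pd_eq_apply (hasFDerivAt_comp_position (hM _ _))]
  simp
  refine Finset.sum_congr rfl fun i _ => Finset.sum_congr rfl fun j _ => ?_
  ring

theorem pd_inr_kinetic (hM : ∀ i j, DifferentiableAt ℝ (fun x => M x i j) (position ι z))
    (hs : ∀ i j, M (position ι z) i j = M (position ι z) j i) (k : ι) :
    pd (Sum.inr k) (kinetic M) z = ∑ j, M (position ι z) k j * z (Sum.inr j) := by
  classical
  have h0 : ∀ i j, pd (Sum.inr k) (fun z => M (position ι z) i j) z = 0 := fun i j => by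
    rw [HasFDerivAt.pd_eq_apply (hasFDerivAt_comp_position (hM i j)),
      ContinuousLinearMap.comp_apply, position_single_inr, map_zero]
  rw [pd_kinetic hM]
  simp only [h0, zero_mul, zero_add, mul_add, Finset.sum_add_distrib]
  have e1 : ∑ i, ∑ j, M (position ι z) i j *
      ((Pi.single (Sum.inr k) 1 : ι ⊕ ι → ℝ) (Sum.inr i) * z (Sum.inr j)) =
      ∑ j, M (position ι z) k j * z (Sum.inr j) := by
    rw [Finset.sum_comm]
    simp [Pi.single_apply]
  have e2 : ∑ i, ∑ j, M (position ι z) i j *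
      (z (Sum.inr i) * (Pi.single (Sum.inr k) 1 : ι ⊕ ι → ℝ) (Sum.inr j)) =
      ∑ j, M (position ι z) k j * z (Sum.inr j) := by
    simp [Pi.single_apply]
    exact Finset.sum_congr rfl fun i _ => by rw [hs]
  rw [e1, e2]
  ring

theorem pd_inl_kinetic (hM : ∀ i j, DifferentiableAt ℝ (fun x => M x i j) (position ι z)) (k : ι) :
    pd (Sum.inl k) (kinetic M) z = (∑ i, ∑ j,
      pd (Sum.inl k) (fun z => M (position ι z) i j) z * z (Sum.inr i) * z (Sum.inr j)) / 2 := by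
  classical
  rw [pd_kinetic hM]
  simp

variable {κ : Type} {N : Set (κ → ℝ)} {Z : (κ → ℝ) → κ → ℝ} {O : Set (ι ⊕ ι → ℝ)}
  {X : (ι ⊕ ι → ℝ) → ι ⊕ ι → ℝ}

/-- The vector potential is known if the canonical system of the shifted kinetic energy is. -/
theorem Quad.vectorPotential [DecidableEq ι] (hO : IsOpen O) {a : (ι → ℝ) → ι → ℝ}
    (hM : ∀ z ∈ O, ∀ i j, DifferentiableAt ℝ (fun x => M x i j) (position ι z))
    (ha : ∀ z ∈ O, DifferentiableAt ℝ a (position ι z))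
    (hdet : ∀ z ∈ O, (M (position ι z)).det ≠ 0)
    (hX : ∀ z ∈ O, ∀ i, X z (Sum.inl i) =
      ∑ j, M (position ι z) i j * (z (Sum.inr j) + a (position ι z) j))
    (hq : ∀ k, Quad N Z O (fun z => X z k)) (i : ι) :
    Quad N Z O (fun z => a (position ι z) i) := by
  have haj : ∀ z ∈ O, ∀ j, DifferentiableAt ℝ (fun x => a x j) (position ι z) :=
    fun z hz j => differentiableAt_pi.1 (ha z hz) j
  -- The velocity is affine in the momenta with linear part M, and the product Ma is its constant
  -- term; a momentum derivative therefore isolates M.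
  have hMq : ∀ i j, Quad N Z O (fun z => M (position ι z) i j) := fun i j =>
    ((hq (Sum.inl i)).deriv (Sum.inr j)).congr fun z hz =>
      pd_inr_of_affine hO (m := fun j x => M x i j) (b := fun x => ∑ j, M x i j * a x j)
        (fun z hz => by
          rw [hX z hz, ← Finset.sum_add_distrib]
          exact Finset.sum_congr rfl fun j _ => mul_add _ _ _) hz (hM z hz i)
        (DifferentiableAt.fun_sum fun j _ => (hM z hz i j).mul (haj z hz j)) j
  -- The potential is then a = M⁻¹ẋ - p.
  have hinv := Quad.matrix_inv hO hMq hdet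
  refine ((Quad.sum hO Finset.univ fun j _ => (hinv i j).mul (hq (Sum.inl j))).sub
    (.coord hO (Sum.inr i))).congr fun z hz => ?_
  have h1 : (fun j => X z (Sum.inl j)) =
      (M (position ι z)).mulVec (fun j => z (Sum.inr j) + a (position ι z) j) :=
    funext (hX z hz)
  have h2 : (M (position ι z))⁻¹.mulVec (fun j => X z (Sum.inl j)) =
      fun j => z (Sum.inr j) + a (position ι z) j := by
    rw [h1, Matrix.mulVec_mulVec, Matrix.nonsing_inv_mul _ (hdet z hz).isUnit, Matrix.one_mulVec]
  have h3 := congrFun h2 i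
  simp only [Matrix.mulVec, dotProduct] at h3
  change (∑ j, (M (position ι z))⁻¹ i j * X z (Sum.inl j)) - z (Sum.inr i) = _
  rw [h3, add_sub_cancel_left]

/-- The magnetic field is known if the magnetic geodesic system is. -/
theorem Quad.magneticField [DecidableEq ι] (hO : IsOpen O) {e : ℝ} {F : (ι → ℝ) → ι → ι → ℝ}
    (hM : ∀ z ∈ O, ∀ i j, DifferentiableAt ℝ (fun x => M x i j) (position ι z))
    (hs : ∀ z ∈ O, ∀ i j, M (position ι z) i j = M (position ι z) j i)
    (hF : ∀ z ∈ O, ∀ i j, DifferentiableAt ℝ (fun x => F x i j) (position ι z))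
    (hdet : ∀ z ∈ O, (M (position ι z)).det ≠ 0)
    (hq : ∀ k, Quad N Z O (fun z => magField e F (kinetic M) z k)) (i j : ι) :
    Quad N Z O (fun z => e * F (position ι z) i j) := by
  have hX : ∀ z ∈ O, ∀ i, magField e F (kinetic M) z (Sum.inl i) =
      ∑ j, M (position ι z) i j * z (Sum.inr j) := fun z hz i =>
    pd_inr_kinetic (hM z hz) (hs z hz) i
  have hMq : ∀ i j, Quad N Z O (fun z => M (position ι z) i j) := fun i j =>
    ((hq (Sum.inl i)).deriv (Sum.inr j)).congr fun z hz =>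
      pd_inr_of_affine hO (m := fun j x => M x i j) (b := fun _ => 0)
        (fun z hz => by rw [hX z hz, add_zero]) hz (hM z hz i) (differentiableAt_const _) j
  have hinv := Quad.matrix_inv hO hMq hdet
  -- The part of -ṗᵢ left after removing the metric term is e ∑ F Mp. It is linear in p, so a
  -- momentum derivative gives the matrix eFM, and multiplication by M⁻¹ gives eF.
  let R : ι → (ι ⊕ ι → ℝ) → ℝ := fun i z => -magField e F (kinetic M) z (Sum.inr i) -
    2⁻¹ * ∑ j, ∑ k, pd (Sum.inl i) (fun z => M (position ι z) j k) z * z (Sum.inr j) * z (Sum.inr k)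
  have hRq : ∀ i, Quad N Z O (R i) := fun i =>
    (hq (Sum.inr i)).neg.sub ((Quad.const hO _).mul (Quad.sum hO _ fun j _ => Quad.sum hO _ fun k _ =>
      (((hMq j k).deriv (Sum.inl i)).mul (.coord hO (Sum.inr j))).mul (.coord hO (Sum.inr k))))
  have hR : ∀ z ∈ O, ∀ i, R i z = ∑ k, (∑ j, e * F (position ι z) i j * M (position ι z) j k) *
      z (Sum.inr k) + 0 := by
    intro z hz i
    simp only [R, magField, pd_inl_kinetic (hM z hz), pd_inr_kinetic (hM z hz) (hs z hz)]
    have h1 : ∑ k, (∑ j, e * F (position ι z) i j * M (position ι z) j k) * z (Sum.inr k) =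
        e * ∑ j, F (fun k => z (Sum.inl k)) i j * ∑ k, M (position ι z) j k * z (Sum.inr k) := by
      simp only [Finset.sum_mul, Finset.mul_sum]
      rw [Finset.sum_comm]
      refine Finset.sum_congr rfl fun j _ => Finset.sum_congr rfl fun k _ => ?_
      rw [position_apply]
      ring
    rw [h1]
    ring
  have hFM : ∀ i k, Quad N Z O (fun z => ∑ j, e * F (position ι z) i j * M (position ι z) j k) :=
    fun i k => ((hRq i).deriv (Sum.inr k)).congr fun z hz =>
      pd_inr_of_affine hO (m := fun k x => ∑ j, e * F x i j * M x j k) (b := fun _ => 0)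
        (fun z hz => hR z hz i) hz (fun k => DifferentiableAt.fun_sum fun j _ =>
          ((hF z hz i j).const_mul e).mul (hM z hz j k)) (differentiableAt_const _) k
  refine (Quad.sum hO Finset.univ fun k _ => (hFM i k).mul (hinv k j)).congr fun z hz => ?_
  have h1 : ((Matrix.of fun i j => e * F (position ι z) i j) * M (position ι z)) *
      (M (position ι z))⁻¹ = Matrix.of fun i j => e * F (position ι z) i j :=
    Matrix.mul_nonsing_inv_cancel_right _ _ (hdet z hz).isUnit
  have h2 := congrFun (congrFun h1 i) j
  simpa [Matrix.mul_apply] using h2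

end Quadratic

/-! ### The inverse momentum shift -/

section Shift

variable {ι : Type}

theorem momentumShift_neg (e : ℝ) (A : (ι → ℝ) → ι → ℝ) (z : ι ⊕ ι → ℝ) :
    momentumShift (-e) A (momentumShift e A z) = z := by
  ext (i | i)
  · rfl
  · simp [momentumShift]

theorem momentumShift_neg' (e : ℝ) (A : (ι → ℝ) → ι → ℝ) (z : ι ⊕ ι → ℝ) :
    momentumShift e A (momentumShift (-e) A z) = z := by
  simpa using momentumShift_neg (-e) A z

variable [Fintype ι]

theorem contDiffOn_momentumShift (e : ℝ) {A : (ι → ℝ) → ι → ℝ} {W : Set (ι → ℝ)}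
    (hA : ContDiffOn ℝ ∞ A W) : ContDiffOn ℝ ∞ (momentumShift e A) (phaseDomain W) := by
  have h1 : ContDiffOn ℝ ∞ (fun z => A (position ι z)) (phaseDomain W) :=
    hA.comp (position ι).contDiff.contDiffOn fun z hz => hz
  refine contDiffOn_pi.2 ?_
  rintro (i | i)
  · exact (contDiff_apply ℝ ℝ (Sum.inl i)).contDiffOn
  · exact (contDiff_apply ℝ ℝ (Sum.inr i)).contDiffOn.add
      (contDiffOn_const.mul (contDiffOn_pi.1 h1 i))

theorem fderiv_momentumShift_neg (e : ℝ) {A : (ι → ℝ) → ι → ℝ} {z : ι ⊕ ι → ℝ}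
    (hA : DifferentiableAt ℝ A (position ι z)) (v : ι ⊕ ι → ℝ) :
    fderiv ℝ (momentumShift (-e) A) (momentumShift e A z)
      (fderiv ℝ (momentumShift e A) z v) = v := by
  rw [(hasFDerivAt_momentumShift e (z := z) hA.hasFDerivAt).fderiv,
    (hasFDerivAt_momentumShift (-e) (z := momentumShift e A z) hA.hasFDerivAt).fderiv]
  have hp : position ι (shiftDeriv e (fderiv ℝ A (position ι z)) v) = position ι v := by
    ext j
    exact shiftDeriv_inl _ _ _ _
  ext (i | i)
  · rw [shiftDeriv_inl, shiftDeriv_inl]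
  · rw [shiftDeriv_inr, hp, shiftDeriv_inr]
    ring

end Shift

/-! ### The two directions of the equivalence -/

section Main

variable {E : Type*} [NormedAddCommGroup E] [NormedSpace ℝ E] [FiniteDimensional ℝ E]
  {G : Type*} [TopologicalSpace G] [ChartedSpace E G] [Group G] [LieGroup 𝓘(ℝ, E) ∞ G]
  {n : ℕ} {B : LinearMap.BilinForm ℝ (GroupLieAlgebra 𝓘(ℝ, E) G)} (hB : B.Nondegenerate)
  {φ : OpenPartialHomeomorph G (Fin n → ℝ)}

omit [LieGroup 𝓘(ℝ, E) ∞ G] in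
theorem geodesicHam_eq_kinetic : geodesicHam B hB φ = kinetic (coMetric B hB φ) :=
  funext (geodesicHam_eq B hB φ)

theorem differentiableAt_coMetric (hφ : IsLocalCoordinates E φ) {x : Fin n → ℝ}
    (hx : x ∈ φ.target) (i j : Fin n) :
    DifferentiableAt ℝ (fun x => coMetric B hB φ x i j) x :=
  ((contDiffOn_coMetric hB hφ i j).contDiffAt (φ.open_target.mem_nhds hx)).differentiableAt (by simp)

namespace CentralExtension

variable {F : LinearMap.BilinForm ℝ (GroupLieAlgebra 𝓘(ℝ, E) G)}
  {Ee : Type*} [NormedAddCommGroup Ee] [NormedSpace ℝ Ee] [FiniteDimensional ℝ Ee]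
  {Ge : Type*} [TopologicalSpace Ge] [ChartedSpace Ee Ge] [Group Ge] [LieGroup 𝓘(ℝ, Ee) ∞ Ge]
  {ext : CentralExtension F Ee Ge}

omit [FiniteDimensional ℝ Ee] in
-- The velocity of the reduced system is M(p + eA). Only the product eA is recovered, so e = 0 needs
-- no separate treatment, and the shift needs no more than this.
theorem IsLocalSection.quad_vectorPotential {W : Set (Fin n → ℝ)} {s : (Fin n → ℝ) → Ge}
    (hBs : B.IsSymm) (hφ : IsLocalCoordinates E φ) (hs : ext.IsLocalSection φ W s) (e : ℝ)
    {O : Set (Fin n ⊕ Fin n → ℝ)} (hO : IsOpen O) (hOW : O ⊆ phaseDomain W) (i : Fin n) :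
    Quad O (ext.reducedField B hB e s) O
      (fun z => e * ext.vectorPotential φ s (position (Fin n) z) i) := by
  have hA : ∀ z ∈ O, DifferentiableAt ℝ (ext.vectorPotential φ s) (position (Fin n) z) :=
    fun z hz => hs.differentiableAt_vectorPotential hφ (hOW hz)
  have hT : ∀ z ∈ O, position (Fin n) z ∈ φ.target := fun z hz => hs.2.1 (hOW hz)
  refine Quad.vectorPotential (M := coMetric B hB φ) (X := ext.reducedField B hB e s)
    (a := fun x i => e * ext.vectorPotential φ s x i) hO
    (fun z hz => differentiableAt_coMetric hB hφ (hT z hz))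
    (fun z hz => (hA z hz).const_smul e)
    (fun z hz => det_coMetric_ne_zero hB hφ (hT z hz)) (fun z hz i => ?_)
    (fun k => .component hO k) i
  rw [hs.reducedField_eq hB hφ e (hOW hz)]
  refine (pd_inr_comp_momentumShift (hA z hz)
    (differentiableAt_geodesicHam hB hφ (hT z hz)) i).trans ?_
  rw [geodesicHam_eq_kinetic]
  exact pd_inr_kinetic (z := momentumShift e (ext.vectorPotential φ s) z)
    (differentiableAt_coMetric hB hφ (hT z hz)) (fun i j => coMetric_comm hB φ hBs _ i j) i

/-- Integrability passes from the magnetic geodesic flow to the reduced flow. -/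
theorem reducedFlowIntegrable (hBs : B.IsSymm) (hφ : IsLocalCoordinates E φ) (e : ℝ)
    (h : IntegrableInQuadratures (phaseDomain φ.target) (magneticGeodesicField B hB F e φ)) :
    ext.ReducedFlowIntegrable B hB e φ := by
  intro W s hs O hOW hO ⟨z, hz⟩
  set A := ext.vectorPotential φ s with hAdef
  have hA := hs.contDiffOn_vectorPotential hφ
  have hWo : IsOpen (phaseDomain W) := isOpen_phaseDomain hs.1
  have hS := contDiffOn_momentumShift e hA
  have hS' := contDiffOn_momentumShift (-e) hA
  -- This set is the image of O under the shift. Integrability is applied on exactly this set, so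
  -- that the magnetic field on it is expressible through the reduced field on O.
  have hO' : IsOpen (phaseDomain W ∩ momentumShift (-e) A ⁻¹' O) :=
    hS'.continuousOn.isOpen_inter_preimage hWo hO
  have hSO : MapsTo (momentumShift e A) O (phaseDomain W ∩ momentumShift (-e) A ⁻¹' O) :=
    fun z hz => ⟨show z ∈ phaseDomain W from hOW hz, by rwa [mem_preimage, momentumShift_neg]⟩
  have hsol := h _ (fun z hz => hs.2.1 hz.1) hO' ⟨_, hSO hz⟩
  refine HasQuadSolution.of_conj (X := magneticGeodesicField B hB F e φ)
    (Y := ext.reducedField B hB e s) hO hO' (hS.mono hOW) (hS'.mono inter_subset_left)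
    (fun z hz => hz.2) (fun z _ => momentumShift_neg e A z) (fun z _ => momentumShift_neg' e A z)
    (fun z hz => hs.fderiv_momentumShift_reducedField hB hφ e (z := z) (hOW hz)) ?_
    (fun k => .component hO k) hsol
  rintro (i | i)
  · exact .coord hO (Sum.inl i)
  · exact (Quad.coord hO (Sum.inr i)).add (hs.quad_vectorPotential hB hBs hφ e hO hOW i)

/-- Integrability passes from the reduced flow to the magnetic geodesic flow. -/
theorem ReducedFlowIntegrable.integrableInQuadratures (hBs : B.IsSymm)
    (hφ : IsLocalCoordinates E φ) {e : ℝ} (h : ext.ReducedFlowIntegrable B hB e φ) :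
    IntegrableInQuadratures (phaseDomain φ.target) (magneticGeodesicField B hB F e φ) := by
  intro O hOT hO ⟨z₀, hz₀⟩
  set X := magneticGeodesicField B hB F e φ with hX
  set c := position (Fin n) z₀ with hc
  obtain ⟨W₁, s₁, hcW₁, hs₁⟩ := exists_isLocalSection ext hφ (hOT hz₀ : c ∈ φ.target)
  -- the points with the momenta of `z₀`
  let j : (Fin n → ℝ) → Fin n ⊕ Fin n → ℝ := fun x => Sum.elim x fun i => z₀ (Sum.inr i)
  have hj : Continuous j := by
    refine continuous_pi ?_
    rintro (i | i)
    · exact continuous_apply i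
    · exact continuous_const
  have hjc : j c = z₀ := by ext (i | i) <;> rfl
  -- The ball lies in the domain of the section and in the slice of O with the momenta of z₀; being
  -- a ball about c, it contains the rays needed for the radial gauge.
  obtain ⟨r, hr, hball⟩ := Metric.nhds_basis_ball.mem_iff.1
    (inter_mem (hs₁.1.mem_nhds hcW₁) ((hO.preimage hj).mem_nhds (by change j c ∈ O; rwa [hjc])))
  set W := Metric.ball c r with hW
  have hWo : IsOpen W := Metric.isOpen_ball
  have hs₂ := hs₁.mono hWo fun x hx => (hball hx).1
  have hA₁ := hs₂.contDiffOn_vectorPotential hφ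
  -- The gauge function need not be obtainable by quadratures. It only selects the section; what
  -- must be known is the resulting potential.
  have hgauge := contDiffOn_radialGauge hA₁
  have hs := hs₂.mul_fiber hgauge
  set s : (Fin n → ℝ) → Ge :=
    fun x => s₁ x * ext.fiber (-radialGauge c (ext.vectorPotential φ s₁) x) with hsdef
  set A := ext.vectorPotential φ s with hAdef
  have hA := hs.contDiffOn_vectorPotential hφ
  have hOX : ∀ k, Quad O X O (fun z => X z k) := fun k => .component hO k
  have hFq : ∀ i k, Quad O X O (fun z => e * faraday F φ (position (Fin n) z) i k) := by
    refine Quad.magneticField (M := coMetric B hB φ) hO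
      (fun z hz => differentiableAt_coMetric hB hφ (hOT hz))
      (fun z _ i j => coMetric_comm hB φ hBs _ i j)
      (fun z hz i j => ((contDiffOn_faraday F hφ i j).contDiffAt
        (φ.open_target.mem_nhds (hOT hz))).differentiableAt (by simp))
      (fun z hz => det_coMetric_ne_zero hB hφ (hOT hz)) ?_
    rw [← geodesicHam_eq_kinetic]
    exact hOX
  -- The function eF is known on a part of phase space but depends on the position only;
  -- substituting the constant momenta of z₀ makes it a known function on the ball.
  have hFW : ∀ i k, Quad O X W (fun x => e * faraday F φ x i k) := by
    intro i k
    let b : Fin n ⊕ Fin n → (Fin n → ℝ) → ℝ := fun l x => j x l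
    have hb : ∀ l, Quad O X W (b l) := by
      rintro (l | l)
      · exact .coord hWo l
      · exact .const hWo _
    exact (Quad.comp hWo (hFq i k) hb fun x hx => (hball hx).2).congr fun x _ => rfl
  have hAW : ∀ k, Quad O X W (fun x => e * A x k) := by
    intro k
    refine (Quad.radial_integral fun i => hFW i k).congr fun x hx => ?_
    have h1 : A x k = _ := (hs₂.vectorPotential_mul_fiber hφ hgauge hx k).trans
      (sub_pd_radialGauge hA₁ hx k)
    simp only [h1, ← intervalIntegral.integral_const_mul]
    refine intervalIntegral.integral_congr fun t ht => ?_
    rw [uIcc_of_le zero_le_one] at ht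
    simp only [hs₂.curl_vectorPotential hφ (segmentPoint_mem_ball hx ht), Finset.mul_sum]
    exact Finset.sum_congr rfl fun i _ => by ring
  have hPo : IsOpen (phaseDomain W) := isOpen_phaseDomain hWo
  set O₁ := O ∩ phaseDomain W with hO₁def
  have hO₁ : IsOpen O₁ := hO.inter hPo
  have hz₁ : z₀ ∈ O₁ := ⟨hz₀, Metric.mem_ball_self hr⟩
  have hS := contDiffOn_momentumShift e hA
  have hS' := contDiffOn_momentumShift (-e) hA
  have hO' : IsOpen (phaseDomain W ∩ momentumShift e A ⁻¹' O₁) :=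
    hS.continuousOn.isOpen_inter_preimage hPo hO₁
  have hSO : MapsTo (momentumShift (-e) A) O₁ (phaseDomain W ∩ momentumShift e A ⁻¹' O₁) :=
    fun z hz => ⟨hz.2, by rwa [mem_preimage, momentumShift_neg']⟩
  -- The hypothesis for all sections is used for the radial-gauge section, on the image of O₁ under
  -- the inverse shift.
  have hsol := h W s hs _ inter_subset_left hO' ⟨_, hSO hz₁⟩
  refine HasQuadSolution.mono (O := O₁) (HasQuadSolution.of_conj hO₁ hO'
    (hS'.mono inter_subset_right) (hS.mono inter_subset_left)
    (fun z hz => hz.2) (fun z _ => momentumShift_neg' e A z) (fun z _ => momentumShift_neg e A z)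
    (fun z hz => ?_) ?_ (fun k => (hOX k).restrict hO₁ inter_subset_left) hsol) inter_subset_left
  · have h1 := hs.fderiv_momentumShift_reducedField hB hφ e (z := momentumShift (-e) A z)
      (hSO hz).1
    have h2 := fderiv_momentumShift_neg e (A := A) (z := momentumShift (-e) A z)
      (hs.differentiableAt_vectorPotential hφ hz.2)
      (ext.reducedField B hB e s (momentumShift (-e) A z))
    rw [h1, momentumShift_neg'] at h2
    exact h2
  · rintro (i | i)
    · exact .coord hO₁ (Sum.inl i)
    · refine ((Quad.coord hO₁ (Sum.inr i)).sub (Quad.comp hO₁ (hAW i)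
        (fun l => Quad.coord hO₁ (Sum.inl l)) fun z hz => hz.2)).congr fun z _ => ?_
      simp only [momentumShift]
      ring

end CentralExtension

end Main

end MagneticFlow

end

theorem mainTheorem2
    {E : Type*} [NormedAddCommGroup E] [NormedSpace ℝ E] [FiniteDimensional ℝ E]
    {G : Type*} [TopologicalSpace G] [ChartedSpace E G] [Group G]
    [LieGroup 𝓘(ℝ, E) ∞ G] [ConnectedSpace G]
    {Ee : Type*} [NormedAddCommGroup Ee] [NormedSpace ℝ Ee] [FiniteDimensional ℝ Ee]
    {Ge : Type*} [TopologicalSpace Ge] [ChartedSpace Ee Ge] [Group Ge]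
    [LieGroup 𝓘(ℝ, Ee) ∞ Ge] [ConnectedSpace Ge]
    (B : LinearMap.BilinForm ℝ (GroupLieAlgebra 𝓘(ℝ, E) G)) (_hBs : B.IsSymm)
    (hB : B.Nondegenerate)
    (F : LinearMap.BilinForm ℝ (GroupLieAlgebra 𝓘(ℝ, E) G)) (_hF : MagneticFlow.IsTwoCocycle F)
    (ext : MagneticFlow.CentralExtension F Ee Ge) (e : ℝ)
    {n : ℕ} (φ : OpenPartialHomeomorph G (Fin n → ℝ))
    (_hφ : MagneticFlow.IsLocalCoordinates E φ) :
    (MagneticFlow.IntegrableInQuadratures (MagneticFlow.phaseDomain φ.target)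
        (MagneticFlow.magneticGeodesicField B hB F e φ) ↔
      ext.ReducedFlowIntegrable B hB e φ) ∧
    ∀ (W : Set (Fin n → ℝ)) (s : (Fin n → ℝ) → Ge), ext.IsLocalSection φ W s →
      -- the coordinate along the centre is cyclic
      (∀ w ∈ MagneticFlow.phaseDomain {y : Option (Fin n) → ℝ | (fun i => y (some i)) ∈ W},
        MagneticFlow.hamField (ext.extHam B hB s) w (Sum.inr none) = 0) ∧
      -- on each level of its momentum the other equations form a closed subsystem
      (∀ z ∈ MagneticFlow.phaseDomain W, ∀ (g0 : ℝ) (i : Fin n),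
        MagneticFlow.hamField (ext.extHam B hB s)
            (MagneticFlow.CentralExtension.levelPoint e g0 z) (Sum.inl (some i)) =
          ext.reducedField B hB e s z (Sum.inl i) ∧
        MagneticFlow.hamField (ext.extHam B hB s)
            (MagneticFlow.CentralExtension.levelPoint e g0 z) (Sum.inr (some i)) =
          ext.reducedField B hB e s z (Sum.inr i)) ∧
      -- the vector potential is a smooth primitive of the magnetic field
      ContDiffOn ℝ ∞ (ext.vectorPotential φ s) W ∧
      (∀ x ∈ W, ∀ i j : Fin n,
        MagneticFlow.pd i (fun y => ext.vectorPotential φ s y j) x -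
          MagneticFlow.pd j (fun y => ext.vectorPotential φ s y i) x =
        MagneticFlow.faraday F φ x i j) ∧
      -- the shift of momenta takes the subsystem to the magnetic geodesic flow
      (∀ z ∈ MagneticFlow.phaseDomain W,
        fderiv ℝ (MagneticFlow.momentumShift e (ext.vectorPotential φ s)) z
            (ext.reducedField B hB e s z) =
          MagneticFlow.magneticGeodesicField B hB F e φ
            (MagneticFlow.momentumShift e (ext.vectorPotential φ s) z)) := by
  refine ⟨⟨MagneticFlow.CentralExtension.reducedFlowIntegrable hB _hBs _hφ e,
    fun h => h.integrableInQuadratures hB _hBs _hφ⟩, fun W s hs =>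
    ⟨fun w hw => ?_, fun z hz g0 i => ⟨?_, ?_⟩, hs.contDiffOn_vectorPotential _hφ,
      fun x hx i j => hs.curl_vectorPotential _hφ hx i j,
      fun z hz => hs.fderiv_momentumShift_reducedField hB _hφ e hz⟩⟩
  · exact (congrArg Neg.neg (hs.pd_center_extHam hB _hφ hw)).trans neg_zero
  · exact (hs.pd_extHam_levelPoint hB _hφ e g0 hz (Sum.inr i)).trans
      (hs.pd_extHam_levelPoint hB _hφ e 0 hz (Sum.inr i)).symm
  · exact congrArg Neg.neg ((hs.pd_extHam_levelPoint hB _hφ e g0 hz (Sum.inl i)).trans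
      (hs.pd_extHam_levelPoint hB _hφ e 0 hz (Sum.inl i)).symm)
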